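/- Let $A\subset\mathbb R^2$ be a finite set with no three points on a line, and let $\omega:A\to\mathbb R$ be a height function such that no four lifted points $p'=(p,\omega(p))$, $p\in A$, lie on a common non-vertical plane. A triangulation of $A$ is a geometric simplicial complex with vertices in $A$ (not necessarily using all of $A$) and underlying space $\operatorname{conv}A$. An up-flip from a triangulation $T_1$ of $A$ to a triangulation $T_2$ of $A$ is given by four points of $A$ such that the (projected) lower faces of the tetrahedron spanned by the four lifted points are triangles of $T_1$, its upper faces are triangles of $T_2$, and all other triangles of $T_1$ and $T_2$ coincide (so it is a 2-2, 1-3 or 3-1 flip); a down-flip is the reverse of an up-flip. The directed flip poset is the set of all triangulations of $A$ ordered by sequences of up-flips. Its upper (resp. lower) extreme node is the farthest point regular (resp. regular) triangulation of $(A,\omega)$, whose triangles are the projections of the upper (resp. lower) faces of the convex hull of the lifted points. A triangulation is an external node if it is not an inner node of any path of up-flips, and a non-extreme node if it is external and is neither of the two extreme nodes. An edge of a triangulation $T$ that is shared by two triangles $abc,abd$ of $T$ is locally non-regular with respect to up-flips (resp. down-flips) if $d'$ lies strictly above (resp. below) the plane through $a',b',c'$; it is flippable if some subcomplex of $T$ has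 underlying space $\operatorname{conv}\{a,b,c,d\}$, and unflippable otherwise. A point of $A$ is interior if it lies in the interior of $\operatorname{conv}A$; an interior point is upper (resp. lower) interior if it is a vertex of the upper (resp. lower) extreme triangulation. A vertex of $T$ is a redundant interior vertex with respect to up-flips (resp. down-flips) if it is an interior point of $A$ that is not upper (resp. not lower) interior. Theorem. Let $T$ be a non-extreme node of the directed flip poset. Then $T$ admits no up-flip or admits no down-flip. Moreover, for each of the two directions in which $T$ admits no flip, the following holds with respect to flips in that direction: $T$ contains at least $3$ redundant interior vertices, and there is a (simple) cycle, with at least $3$ vertices, that consists of unflippable locally non-regular edges of $T$ and all of whose vertices are redundant interior vertices. If, in addition, every interior point of $A$ is upper or lower interior, then the redundant interior vertices of $T$ with respect to up-flips (resp. down-flips) are lower interior (resp. upper interior). -/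

import Mathlib

namespace DirectedFlips

open Geometry

/-- The Euclidean plane. -/
abbrev Plane : Type := EuclideanSpace ℝ (Fin 2)

/-- The two directions of flips: `up` and `down`. -/
inductive Dir where
  | up : Dir
  | down : Dir

/-- The opposite direction. -/
def Dir.opp : Dir → Dir
  | .up => .down
  | .down => .up

/-- `s.lt x y`: the height `y` lies strictly further than the height `x` in direction `s`,
i.e. `x < y` for `up` and `y < x` for `down`. -/
def Dir.lt : Dir → ℝ → ℝ → Prop
  | .up, x, y => x < y
  | .down, x, y => y < x

/-- No three points of `A` lie on a common line. -/
def InGeneralPosition (A : Finset Plane) : Prop :=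
  ∀ t ⊆ A, t.card = 3 → ¬ Collinear ℝ (t : Set Plane)

/-- No four lifted points `(p, ω p)`, `p ∈ A`, lie on a common non-vertical plane of `ℝ³`; such a
plane is the graph of an affine function `ℓ`. -/
def IsGenericHeight (A : Finset Plane) (ω : Plane → ℝ) : Prop :=
  ∀ ℓ : Plane →ᵃ[ℝ] ℝ, ∀ q ⊆ A, q.card = 4 → ¬ ∀ p ∈ q, ω p = ℓ p

/-- `K` is a triangulation of the point set `A`: a geometric simplicial complex whose vertices
belong to `A` (not all points of `A` need be used) and whose underlying space is `conv A`. -/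
structure IsTriangulation (A : Finset Plane) (K : SimplicialComplex ℝ Plane) : Prop where
  vertices_subset : K.vertices ⊆ (A : Set Plane)
  space_eq : K.space = convexHull ℝ (A : Set Plane)

/-- The set of triangles of a simplicial complex. -/
def triangles (K : SimplicialComplex ℝ Plane) : Set (Finset Plane) :=
  {t | t ∈ K.faces ∧ t.card = 3}

/-- The projections of the upper (`s = up`) or lower (`s = down`) triangular facets of the convex
hull of the lifted point set `B^ω`: the triples of points of `B` that span, after lifting, a
non-vertical plane (the graph of `ℓ`) such that all other lifted points of `B` lie strictly below
(resp. strictly above) this plane. -/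
def extremeTriangles (B : Finset Plane) (ω : Plane → ℝ) (s : Dir) : Set (Finset Plane) :=
  {t | t ⊆ B ∧ t.card = 3 ∧ AffineIndependent ℝ ((↑) : t → Plane) ∧
    ∃ ℓ : Plane →ᵃ[ℝ] ℝ, (∀ p ∈ t, ω p = ℓ p) ∧ ∀ p ∈ B, p ∉ t → s.lt (ω p) (ℓ p)}

/-- `K` is the extreme node in direction `s`: the farthest point regular triangulation of `(A, ω)`
for `s = up`, the regular triangulation of `(A, ω)` for `s = down`. -/
def IsExtreme (A : Finset Plane) (ω : Plane → ℝ) (s : Dir) (K : SimplicialComplex ℝ Plane) :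
    Prop :=
  IsTriangulation A K ∧ triangles K = extremeTriangles A ω s

/-- The triangulation `K'` of `A` arises from the triangulation `K` of `A` by a flip in direction
`s` supported by the four points `q`. For `s = up`, the lower faces of the tetrahedron spanned by
the lifted points of `q` appear in `K`, its upper faces appear in `K'`, and all other triangles
agree. This covers the 2-2, 1-3 and 3-1 flips. -/
def Flip (A : Finset Plane) (ω : Plane → ℝ) (s : Dir) (K K' : SimplicialComplex ℝ Plane) : Prop :=
  IsTriangulation A K ∧ IsTriangulation A K' ∧
    ∃ q ⊆ A, q.card = 4 ∧
      extremeTriangles q ω s.opp ⊆ triangles K ∧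
      extremeTriangles q ω s ⊆ triangles K' ∧
      triangles K \ extremeTriangles q ω s.opp = triangles K' \ extremeTriangles q ω s

/-- `K` admits no flip in direction `s`. -/
def NoFlip (A : Finset Plane) (ω : Plane → ℝ) (s : Dir) (K : SimplicialComplex ℝ Plane) : Prop :=
  ¬ ∃ K', Flip A ω s K K'

/-- `K` is an external node of the directed flip graph: it is not an inner node of any path, so
that it can only be the start or the end of a monotone sequence of flips. -/
def IsExternal (A : Finset Plane) (ω : Plane → ℝ) (K : SimplicialComplex ℝ Plane) : Prop :=
  IsTriangulation A K ∧
    ¬ ((∃ K₁, Flip A ω .up K₁ K) ∧ ∃ K₂, Flip A ω .up K K₂)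

/-- A non-extreme node: an external node that is neither of the two extreme nodes. -/
def IsNonExtreme (A : Finset Plane) (ω : Plane → ℝ) (K : SimplicialComplex ℝ Plane) : Prop :=
  IsExternal A ω K ∧ ∀ s, ¬ IsExtreme A ω s K

/-- An interior vertex of `A`. -/
def IsInterior (A : Finset Plane) (a : Plane) : Prop :=
  a ∈ A ∧ a ∈ interior (convexHull ℝ (A : Set Plane))

/-- Upper interior (`s = up`) and lower interior (`s = down`) vertices of `A`: interior vertices
that appear in the extreme triangulation in direction `s`. -/
def IsInteriorToward (A : Finset Plane) (ω : Plane → ℝ) (s : Dir) (a : Plane) : Prop :=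
  IsInterior A a ∧ ∃ t ∈ extremeTriangles A ω s, a ∈ t

/-- A redundant interior vertex of `K` with respect to flips in direction `s`: an interior vertex
of `A` that is used by `K` but not by the extreme triangulation in direction `s`. -/
def IsRedundant (A : Finset Plane) (ω : Plane → ℝ) (s : Dir) (K : SimplicialComplex ℝ Plane)
    (a : Plane) : Prop :=
  a ∈ K.vertices ∧ IsInterior A a ∧ ¬ IsInteriorToward A ω s a

/-- `c` and `d` are the apexes of two different triangles of `K` that share the edge `e`. -/
def AreApexes (K : SimplicialComplex ℝ Plane) (e : Finset Plane) (c d : Plane) : Prop :=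
  e ∈ K.faces ∧ e.card = 2 ∧ c ∉ e ∧ d ∉ e ∧ c ≠ d ∧
    (∃ f ∈ K.faces, (f : Set Plane) = insert c (e : Set Plane)) ∧
    ∃ f ∈ K.faces, (f : Set Plane) = insert d (e : Set Plane)

/-- The edge `e` of `K` is locally non-regular with respect to flips in direction `s`: it is shared
by two triangles with apexes `c` and `d`, and the lifted point of `d` lies strictly above
(`s = up`), resp. below (`s = down`), the plane through the lifted points of `e` and `c`. -/
def IsLocallyNonRegular (ω : Plane → ℝ) (s : Dir) (K : SimplicialComplex ℝ Plane)
    (e : Finset Plane) : Prop :=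
  ∃ c d, AreApexes K e c d ∧
    ∃ ℓ : Plane →ᵃ[ℝ] ℝ, (∀ p ∈ e, ω p = ℓ p) ∧ ω c = ℓ c ∧ s.lt (ℓ d) (ω d)

/-- The edge `e` of `K`, shared by two triangles with apexes `c` and `d`, is flippable: some
subcomplex of `K` has the convex hull of `e ∪ {c, d}` as its underlying space. -/
def IsFlippable (K : SimplicialComplex ℝ Plane) (e : Finset Plane) : Prop :=
  ∃ c d, AreApexes K e c d ∧
    ∃ S : SimplicialComplex ℝ Plane, S.faces ⊆ K.faces ∧
      S.space = convexHull ℝ (insert c (insert d (e : Set Plane)))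

open Classical in
/-- The graph formed by the unflippable edges of `K` that are locally non-regular with respect to
flips in direction `s`. -/
def blockedGraph (ω : Plane → ℝ) (s : Dir) (K : SimplicialComplex ℝ Plane) :
    SimpleGraph Plane where
  Adj a b := a ≠ b ∧ IsLocallyNonRegular ω s K {a, b} ∧ ¬ IsFlippable K {a, b}
  symm := ⟨fun a b h => ⟨h.1.symm, by rw [Finset.pair_comm]; exact h.2⟩⟩
  loopless := ⟨fun _ h => h.1 rfl⟩

end DirectedFlips

namespace DirectedFlips

open Geometry Set

open scoped Classical Topology

/-! ### Affine functions and barycentric coordinates -/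

theorem affineMap_comb_two (ℓ : Plane →ᵃ[ℝ] ℝ) {α β : ℝ} (h : α + β = 1) (a b : Plane) :
    ℓ (α • a + β • b) = α * ℓ a + β * ℓ b := by
  have := fun x => congrFun ℓ.decomp x
  simp only [Pi.add_apply] at this
  rw [this, this a, this b]
  simp only [map_add, map_smul, smul_eq_mul]
  linear_combination (-(ℓ 0)) * h

theorem affineMap_comb_three (ℓ : Plane →ᵃ[ℝ] ℝ) {α β γ : ℝ} (h : α + β + γ = 1)
    (a b c : Plane) :
    ℓ (α • a + β • b + γ • c) = α * ℓ a + β * ℓ b + γ * ℓ c := by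
  have := fun x => congrFun ℓ.decomp x
  simp only [Pi.add_apply] at this
  rw [this, this a, this b, this c]
  simp only [map_add, map_smul, smul_eq_mul]
  linear_combination (-(ℓ 0)) * h

/-- Barycentric coordinates with respect to a triangle in the plane. -/
structure Bary (a b c : Plane) where
  u : Plane →ᵃ[ℝ] ℝ
  v : Plane →ᵃ[ℝ] ℝ
  w : Plane →ᵃ[ℝ] ℝ
  ua : u a = 1
  ub : u b = 0
  uc : u c = 0
  va : v a = 0
  vb : v b = 1
  vc : v c = 0
  wa : w a = 0
  wb : w b = 0
  wc : w c = 1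
  sum_eq (x : Plane) : u x + v x + w x = 1
  comb_eq (x : Plane) : x = u x • a + v x • b + w x • c
  mem_interior (x : Plane) :
    x ∈ interior (convexHull ℝ ({a, b, c} : Set Plane)) ↔ 0 < u x ∧ 0 < v x ∧ 0 < w x

theorem range_triple (a b c : Plane) : range ![a, b, c] = {a, b, c} := by
  ext x
  simp only [Matrix.range_cons, Matrix.range_empty, mem_union, mem_singleton_iff, mem_insert_iff,
    mem_empty_iff_false, or_false]

theorem exists_bary {a b c : Plane} (h : AffineIndependent ℝ ![a, b, c]) :
    Nonempty (Bary a b c) := by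
  have htop : affineSpan ℝ (range ![a, b, c]) = ⊤ := by
    rw [h.affineSpan_eq_top_iff_card_eq_finrank_add_one]; simp
  let B : AffineBasis (Fin 3) ℝ Plane := ⟨_, h, htop⟩
  have hB0 : B 0 = a := rfl
  have hB1 : B 1 = b := rfl
  have hB2 : B 2 = c := rfl
  have hr : range B = {a, b, c} := by
    rw [show range B = range ![a, b, c] from rfl, range_triple]
  refine ⟨⟨B.coord 0, B.coord 1, B.coord 2, ?_, ?_, ?_, ?_, ?_, ?_, ?_, ?_, ?_, ?_, ?_, ?_⟩⟩
  any_goals (first | rw [← hB0] | rw [← hB1] | rw [← hB2]); simp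
  · intro x
    have := B.sum_coord_apply_eq_one x
    rwa [Fin.sum_univ_three] at this
  · intro x
    have := B.linear_combination_coord_eq_self x
    rw [Fin.sum_univ_three] at this
    exact this.symm
  · intro x
    rw [← hr, B.interior_convexHull]
    simp [Fin.forall_fin_succ]

theorem mem_convexHull_triple {a b c x : Plane} :
    x ∈ convexHull ℝ ({a, b, c} : Set Plane) ↔
      ∃ α β γ : ℝ, 0 ≤ α ∧ 0 ≤ β ∧ 0 ≤ γ ∧ α + β + γ = 1 ∧ x = α • a + β • b + γ • c := by
  rw [convexHull_insert (by simp), convexHull_pair]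
  simp only [convexJoin, mem_iUnion, mem_singleton_iff, exists_prop]
  constructor
  · rintro ⟨_, rfl, y, ⟨s, t, hs, ht, hst, rfl⟩, ⟨p, q, hp, hq, hpq, rfl⟩⟩
    refine ⟨p, q * s, q * t, hp, by positivity, by positivity, ?_, ?_⟩
    · linear_combination hpq + q * hst
    · module
  · rintro ⟨α, β, γ, hα, hβ, hγ, h, rfl⟩
    refine ⟨a, rfl, ?_⟩
    rcases eq_or_lt_of_le (add_nonneg hβ hγ) with h0 | h0
    · have h1 : β = 0 := by linarith
      have h2 : γ = 0 := by linarith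
      refine ⟨b, left_mem_segment _ _ _, ⟨α, 0, hα, le_rfl, by linarith, by simp [h1, h2]⟩⟩
    · refine ⟨(β / (β + γ)) • b + (γ / (β + γ)) • c,
        ⟨_, _, by positivity, by positivity, by field_simp, rfl⟩,
        ⟨α, β + γ, hα, h0.le, by linarith, ?_⟩⟩
      rw [smul_add, smul_smul, smul_smul, mul_div_cancel₀ _ h0.ne', mul_div_cancel₀ _ h0.ne']
      module

namespace Bary

variable {a b c : Plane} (B : Bary a b c)

theorem apply_eq (ℓ : Plane →ᵃ[ℝ] ℝ) (x : Plane) :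
    ℓ x = B.u x * ℓ a + B.v x * ℓ b + B.w x * ℓ c := by
  conv_lhs => rw [B.comb_eq x]
  exact affineMap_comb_three ℓ (B.sum_eq x) a b c

theorem mem_convexHull {x : Plane} :
    x ∈ convexHull ℝ ({a, b, c} : Set Plane) ↔ 0 ≤ B.u x ∧ 0 ≤ B.v x ∧ 0 ≤ B.w x := by
  rw [mem_convexHull_triple]
  constructor
  · rintro ⟨α, β, γ, hα, hβ, hγ, h, rfl⟩
    rw [affineMap_comb_three _ h, affineMap_comb_three _ h, affineMap_comb_three _ h]
    simp [B.ua, B.ub, B.uc, B.va, B.vb, B.vc, B.wa, B.wb, B.wc, hα, hβ, hγ]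
  · rintro ⟨h1, h2, h3⟩
    exact ⟨_, _, _, h1, h2, h3, B.sum_eq x, B.comb_eq x⟩

theorem coords_comb {α β γ : ℝ} (h : α + β + γ = 1) :
    B.u (α • a + β • b + γ • c) = α ∧ B.v (α • a + β • b + γ • c) = β ∧
      B.w (α • a + β • b + γ • c) = γ := by
  rw [affineMap_comb_three _ h, affineMap_comb_three _ h, affineMap_comb_three _ h]
  simp [B.ua, B.ub, B.uc, B.va, B.vb, B.vc, B.wa, B.wb, B.wc]

theorem exists_interpolation (B : Bary a b c) (ω : Plane → ℝ) :
    ∃ ℓ : Plane →ᵃ[ℝ] ℝ, ℓ a = ω a ∧ ℓ b = ω b ∧ ℓ c = ω c := by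
  refine ⟨ω a • B.u + ω b • B.v + ω c • B.w, ?_, ?_, ?_⟩ <;>
    simp [B.ua, B.ub, B.uc, B.va, B.vb, B.vc, B.wa, B.wb, B.wc]

theorem not_mem_interior_left (B : Bary a b c) :
    a ∉ interior (convexHull ℝ ({a, b, c} : Set Plane)) := by
  rw [B.mem_interior]; simp [B.va]

end Bary

theorem affineMap_continuous (ℓ : Plane →ᵃ[ℝ] ℝ) : Continuous ℓ :=
  AffineMap.continuous_of_finiteDimensional ℓ

/-- A point of a simplex at which a nonnegative affine function vanishes lies in the face on which
that function vanishes. -/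
theorem mem_convexHull_filter_of_eq_zero {s : Finset Plane} {x : Plane} (ψ : Plane →ᵃ[ℝ] ℝ)
    (hψ : ∀ p ∈ s, 0 ≤ ψ p) (hx : x ∈ convexHull ℝ (s : Set Plane)) (hx0 : ψ x = 0) :
    x ∈ convexHull ℝ ((s.filter fun p => ψ p = 0 : Finset Plane) : Set Plane) := by
  obtain ⟨w, hw0, hw1, rfl⟩ := Finset.mem_convexHull'.1 hx
  have hlin : ψ (∑ y ∈ s, w y • y) = ∑ y ∈ s, w y * ψ y := by
    have := fun x => congrFun ψ.decomp x
    simp only [Pi.add_apply] at this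
    have h2 : ∑ y ∈ s, w y * ψ y = ∑ y ∈ s, (w y * ψ.linear y + w y * ψ 0) :=
      Finset.sum_congr rfl fun y _ => by rw [this y]; ring
    rw [this, map_sum, h2, Finset.sum_add_distrib, ← Finset.sum_mul, hw1]
    simp
  rw [hlin, Finset.sum_eq_zero_iff_of_nonneg
    (fun p hp => mul_nonneg (hw0 p hp) (hψ p hp))] at hx0
  have hz : ∀ p ∈ s, p ∉ s.filter (fun p => ψ p = 0) → w p = 0 := by
    intro p hp hp'
    have := hx0 p hp
    simp only [Finset.mem_filter, hp, true_and] at hp'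
    exact (mul_eq_zero.1 this).resolve_right hp'
  rw [← Finset.sum_subset (Finset.filter_subset _ s)
    (fun p hp hp' => by rw [hz p hp hp', zero_smul])]
  rw [← Finset.sum_subset (Finset.filter_subset _ s) hz] at hw1
  exact Finset.mem_convexHull'.2 ⟨w, fun p hp => hw0 p (Finset.mem_of_mem_filter p hp), hw1, rfl⟩

theorem le_of_mem_convexHull {s : Set Plane} {x : Plane} (ψ : Plane →ᵃ[ℝ] ℝ) {m : ℝ}
    (hψ : ∀ p ∈ s, m ≤ ψ p) (hx : x ∈ convexHull ℝ s) : m ≤ ψ x := by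
  have hc : Convex ℝ (ψ ⁻¹' Ici m) := (convex_Ici m).affine_preimage ψ
  exact convexHull_min hψ hc hx

theorem eq_of_mem_convexHull {s : Set Plane} {x : Plane} (φ ψ : Plane →ᵃ[ℝ] ℝ)
    (h : ∀ p ∈ s, φ p = ψ p) (hx : x ∈ convexHull ℝ s) : φ x = ψ x := by
  have h1 := le_of_mem_convexHull (φ - ψ) (m := 0) (fun p hp => by simp [h p hp]) hx
  have h2 := le_of_mem_convexHull (ψ - φ) (m := 0) (fun p hp => by simp [h p hp]) hx
  simp at h1 h2
  linarith

/-! ### General position, and covering by triangles -/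

theorem InGeneralPosition.indep {A : Finset Plane} (hA : InGeneralPosition A) {a b c : Plane}
    (ha : a ∈ A) (hb : b ∈ A) (hc : c ∈ A) (hab : a ≠ b) (hac : a ≠ c) (hbc : b ≠ c) :
    AffineIndependent ℝ ![a, b, c] := by
  rw [affineIndependent_iff_not_collinear_set]
  have := hA {a, b, c} (by simp [Finset.insert_subset_iff, ha, hb, hc])
    (Finset.card_eq_three.2 ⟨a, b, c, hab, hac, hbc, rfl⟩)
  simpa using this

theorem InGeneralPosition.bary {A : Finset Plane} (hA : InGeneralPosition A) {a b c : Plane}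
    (ha : a ∈ A) (hb : b ∈ A) (hc : c ∈ A) (hab : a ≠ b) (hac : a ≠ c) (hbc : b ≠ c) :
    Nonempty (Bary a b c) :=
  exists_bary (hA.indep ha hb hc hab hac hbc)

theorem InGeneralPosition.mono {A B : Finset Plane} (hA : InGeneralPosition A) (h : B ⊆ A) :
    InGeneralPosition B :=
  fun t ht => hA t (ht.trans h)

variable {A : Finset Plane} {K : SimplicialComplex ℝ Plane}

theorem InGeneralPosition.affineIndependent_coe (hA : InGeneralPosition A) {t : Finset Plane}
    (ht : t ⊆ A) (h3 : t.card = 3) : AffineIndependent ℝ ((↑) : t → Plane) := by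
  obtain ⟨a, b, c, hab, hac, hbc, rfl⟩ := Finset.card_eq_three.1 h3
  have h := (hA.indep (ht (by simp)) (ht (by simp)) (ht (by simp)) hab hac hbc).range
  have hr : range ![a, b, c] = (({a, b, c} : Finset Plane) : Set Plane) := by
    rw [range_triple]; simp
  rw [hr] at h
  exact h

/-- At an interior point of a triangle all barycentric coordinates are positive, whereas the
coordinate of a vertex missing from `s` vanishes on the hull of `s`. -/
theorem subset_of_mem_interior (hA : InGeneralPosition A) {t s : Finset Plane} (ht : t ⊆ A)
    (h3 : t.card = 3) (hs : s ⊆ t) {x : Plane}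
    (hx : x ∈ interior (convexHull ℝ (t : Set Plane))) (hxs : x ∈ convexHull ℝ (s : Set Plane)) :
    t ⊆ s := by
  obtain ⟨a, b, c, hab, hac, hbc, rfl⟩ := Finset.card_eq_three.1 h3
  obtain ⟨B⟩ := hA.bary (ht (by simp)) (ht (by simp)) (ht (by simp)) hab hac hbc
  simp only [Finset.coe_insert, Finset.coe_singleton] at hx
  obtain ⟨h1, h2, h3⟩ := (B.mem_interior x).1 hx
  have key : ∀ ψ : Plane →ᵃ[ℝ] ℝ, ∀ p, p ∉ s → (∀ q ∈ ({a, b, c} : Finset Plane), q ≠ p → ψ q = 0) →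
      ψ x = 0 := by
    intro ψ p hp h
    exact eq_of_mem_convexHull ψ 0 (fun q hq => h q (hs hq) (fun e => hp (e ▸ hq))) hxs
  intro p hp
  by_contra hps
  simp only [Finset.mem_insert, Finset.mem_singleton] at hp
  rcases hp with rfl | rfl | rfl
  · exact h1.ne' (key B.u _ hps (by simp [B.ub, B.uc]))
  · exact h2.ne' (key B.v _ hps (by simp [B.va, B.vc]))
  · exact h3.ne' (key B.w _ hps (by simp [B.wa, B.wb]))

theorem interior_convexHull_nonempty (hA : InGeneralPosition A) {t : Finset Plane} (ht : t ⊆ A)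
    (h3 : t.card = 3) : (interior (convexHull ℝ (t : Set Plane))).Nonempty := by
  obtain ⟨a, b, c, hab, hac, hbc, rfl⟩ := Finset.card_eq_three.1 h3
  obtain ⟨B⟩ := hA.bary (ht (by simp)) (ht (by simp)) (ht (by simp)) hab hac hbc
  refine ⟨(1 / 3 : ℝ) • a + (1 / 3 : ℝ) • b + (1 / 3 : ℝ) • c, ?_⟩
  simp only [Finset.coe_insert, Finset.coe_singleton]
  obtain ⟨h1, h2, h3⟩ := B.coords_comb (α := 1 / 3) (β := 1 / 3) (γ := 1 / 3) (by norm_num)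
  rw [B.mem_interior, h1, h2, h3]
  norm_num

namespace IsTriangulation

theorem mem_vertices_of_mem {s : Finset Plane} (hs : s ∈ K.faces) {p : Plane} (hp : p ∈ s) :
    p ∈ K.vertices :=
  K.down_closed hs (Finset.singleton_subset_iff.2 hp) (Finset.singleton_nonempty p)

theorem subset (hK : IsTriangulation A K) {s : Finset Plane} (hs : s ∈ K.faces) : s ⊆ A :=
  fun _ hp => hK.vertices_subset (mem_vertices_of_mem hs hp)

theorem finite_faces (hK : IsTriangulation A K) : K.faces.Finite :=
  (Finset.finite_toSet A.powerset).subset fun _ hs => by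
    simpa using hK.subset hs

theorem convexHull_subset (hK : IsTriangulation A K) {s : Finset Plane} (hs : s ∈ K.faces) :
    convexHull ℝ (s : Set Plane) ⊆ convexHull ℝ (A : Set Plane) :=
  convexHull_mono (by exact_mod_cast hK.subset hs)

/-- Faces meet in common faces, so the previous lemma applies to `t ∩ s`. This is the main tool for
identifying two triangles that overlap in an interior point. -/
theorem subset_of_mem_interior (hA : InGeneralPosition A) (hK : IsTriangulation A K)
    {s t : Finset Plane} (hs : s ∈ K.faces) (ht : t ∈ triangles K) {x : Plane}
    (hx : x ∈ interior (convexHull ℝ (t : Set Plane))) (hxs : x ∈ convexHull ℝ (s : Set Plane)) :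
    t ⊆ s := by
  have h := K.inter_subset_convexHull ht.1 hs ⟨interior_subset hx, hxs⟩
  rw [← Finset.coe_inter] at h
  exact (DirectedFlips.subset_of_mem_interior hA (hK.subset ht.1) ht.2 Finset.inter_subset_left
    hx h).trans Finset.inter_subset_right

end IsTriangulation

theorem volume_affineSpan_eq_zero {s : Finset Plane} (hs : s.card ≤ 2) :
    MeasureTheory.volume (affineSpan ℝ (s : Set Plane) : Set Plane) = 0 := by
  refine MeasureTheory.Measure.addHaar_affineSubspace _ _ ?_
  intro htop
  have h1 : Module.finrank ℝ (vectorSpan ℝ (s : Set Plane)) = 2 := by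
    rw [← direction_affineSpan, htop, AffineSubspace.direction_top, finrank_top]
    simp
  rcases s.eq_empty_or_nonempty with rfl | hne
  · rw [Finset.coe_empty, vectorSpan_empty, finrank_bot] at h1
    omega
  · obtain ⟨n, hn⟩ := Nat.exists_eq_succ_of_ne_zero (Finset.card_pos.2 hne).ne'
    have := finrank_vectorSpan_image_finset_le ℝ (id : Plane → Plane) s hn
    rw [Finset.image_id] at this
    omega

theorem card_le_three_of_mem_faces {s : Finset Plane} (hs : s ∈ K.faces) : s.card ≤ 3 := by
  have := (K.indep hs).card_le_finrank_succ
  have h2 : Module.finrank ℝ (vectorSpan ℝ (range ((↑) : s → Plane))) ≤ 2 := by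
    refine (Submodule.finrank_le _).trans ?_
    simp
  simp only [Fintype.card_coe] at this
  omega

theorem isClosed_convexHull_finset (s : Finset Plane) : IsClosed (convexHull ℝ (s : Set Plane)) :=
  s.finite_toSet.isClosed_convexHull ℝ

/-- The closed triangles of a triangulation cover the convex hull. -/
theorem IsTriangulation.exists_triangle (hK : IsTriangulation A K)
    (hne : (interior (convexHull ℝ (A : Set Plane))).Nonempty) {x : Plane}
    (hx : x ∈ convexHull ℝ (A : Set Plane)) :
    ∃ t ∈ triangles K, x ∈ convexHull ℝ (t : Set Plane) := by
  by_contra! hcon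
  have hfin : (triangles K).Finite := hK.finite_faces.subset fun t ht => ht.1
  set V : Set Plane := ⋃ t ∈ triangles K, convexHull ℝ (t : Set Plane) with hV
  have hVc : IsClosed V := hfin.isClosed_biUnion fun t _ => isClosed_convexHull_finset t
  have hxV : x ∉ V := by simpa [hV] using hcon
  have hcl : x ∈ closure (interior (convexHull ℝ (A : Set Plane))) := by
    rw [(convex_convexHull ℝ _).closure_interior_eq_closure_of_nonempty_interior hne]
    exact subset_closure hx
  have hO : IsOpen (interior (convexHull ℝ (A : Set Plane)) ∩ Vᶜ) :=
    isOpen_interior.inter hVc.isOpen_compl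
  have hOne : (interior (convexHull ℝ (A : Set Plane)) ∩ Vᶜ).Nonempty := by
    have := mem_closure_iff.1 hcl Vᶜ hVc.isOpen_compl hxV
    rwa [inter_comm] at this
  -- A nonempty open set has positive area, but here it is covered by finitely many faces of
  -- dimension at most one.
  have hpos := hO.measure_pos MeasureTheory.volume hOne
  refine hpos.ne' (MeasureTheory.measure_mono_null (t := ⋃ s ∈ K.faces \ triangles K,
    convexHull ℝ (s : Set Plane)) ?_ ?_)
  · rintro y ⟨hy, hyV⟩
    have hy' := interior_subset hy
    rw [← hK.space_eq, SimplicialComplex.mem_space_iff] at hy'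
    obtain ⟨s, hs, hys⟩ := hy'
    refine mem_biUnion (x := s) ⟨hs, fun hst => hyV (mem_biUnion hst hys)⟩ hys
  · refine (MeasureTheory.measure_biUnion_null_iff
      (hK.finite_faces.subset sdiff_subset).countable).2 ?_
    rintro s ⟨hs, hst⟩
    refine MeasureTheory.measure_mono_null (convexHull_subset_affineSpan _)
      (volume_affineSpan_eq_zero ?_)
    have := card_le_three_of_mem_faces hs
    have h3 : s.card ≠ 3 := fun h => hst ⟨hs, h⟩
    omega

theorem interior_convexHull_mono {s t : Finset Plane} (h : s ⊆ t) :
    interior (convexHull ℝ (s : Set Plane)) ⊆ interior (convexHull ℝ (t : Set Plane)) :=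
  interior_mono (convexHull_mono (by exact_mod_cast h))

/-- A family of triangles that pairwise meet in common faces spans a simplicial complex. -/
theorem exists_complex_of_triangles (hA : InGeneralPosition A) {𝒯 : Set (Finset Plane)}
    (hsub : ∀ t ∈ 𝒯, t ⊆ A) (hcard : ∀ t ∈ 𝒯, t.card = 3)
    (hinter : ∀ t ∈ 𝒯, ∀ t' ∈ 𝒯, convexHull ℝ (t : Set Plane) ∩ convexHull ℝ (t' : Set Plane) ⊆
      convexHull ℝ ((t ∩ t' : Finset Plane) : Set Plane)) :
    ∃ K' : SimplicialComplex ℝ Plane, triangles K' = 𝒯 ∧ K'.vertices ⊆ (A : Set Plane) ∧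
      K'.space = ⋃ t ∈ 𝒯, convexHull ℝ (t : Set Plane) := by
  have hind : ∀ t ∈ 𝒯, AffineIndependent ℝ ((↑) : t → Plane) :=
    fun t ht => hA.affineIndependent_coe (hsub t ht) (hcard t ht)
  let K' : SimplicialComplex ℝ Plane := SimplicialComplex.ofErase {s | ∃ t ∈ 𝒯, s ⊆ t}
    (by
      rintro s ⟨t, ht, hst⟩
      exact (hind t ht).mono (by exact_mod_cast hst))
    (by
      rintro s s' hs's ⟨t, ht, hst⟩
      exact ⟨t, ht, hs's.trans hst⟩)
    (by
      rintro s ⟨t, ht, hst⟩ s' ⟨t', ht', hst'⟩ x ⟨hx, hx'⟩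
      have h1 := hinter t ht t' ht' ⟨convexHull_mono (by exact_mod_cast hst) hx,
        convexHull_mono (by exact_mod_cast hst') hx'⟩
      -- Hulls of subsets of one affinely independent set meet in the hull of the intersection. This
      -- is applied first inside `t`, then inside `t'`.
      have h2 : x ∈ convexHull ℝ ((s ∩ (t ∩ t') : Finset Plane) : Set Plane) := by
        rw [Finset.coe_inter, (hind t ht).convexHull_inter hst Finset.inter_subset_left]
        exact ⟨hx, h1⟩
      have h3 : x ∈ convexHull ℝ (((s ∩ (t ∩ t')) ∩ s' : Finset Plane) : Set Plane) := by
        rw [Finset.coe_inter, (hind t' ht').convexHull_inter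
          (Finset.inter_subset_right.trans Finset.inter_subset_right) hst']
        exact ⟨h2, hx'⟩
      refine convexHull_mono ?_ h3
      rw [← Finset.coe_inter]
      exact_mod_cast Finset.inter_subset_inter_right Finset.inter_subset_left)
  have hfaces : ∀ s, s ∈ K'.faces ↔ (∃ t ∈ 𝒯, s ⊆ t) ∧ s ≠ ∅ := by
    exact fun s => Iff.rfl
  refine ⟨K', ?_, ?_, ?_⟩
  · ext s
    simp only [triangles, mem_ofPred_eq, hfaces]
    constructor
    · rintro ⟨⟨⟨t, ht, hst⟩, -⟩, h3⟩
      rwa [Finset.eq_of_subset_of_card_le hst (by rw [hcard t ht, h3])]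
    · intro hs
      refine ⟨⟨⟨s, hs, subset_rfl⟩, ?_⟩, hcard s hs⟩
      rintro rfl
      simpa using hcard _ hs
  · intro p hp
    rw [SimplicialComplex.mem_vertices, hfaces] at hp
    obtain ⟨⟨t, ht, hpt⟩, -⟩ := hp
    exact hsub t ht (Finset.singleton_subset_iff.1 hpt)
  · ext x
    simp only [SimplicialComplex.mem_space_iff, hfaces, mem_iUnion, exists_prop]
    constructor
    · rintro ⟨s, ⟨⟨t, ht, hst⟩, -⟩, hx⟩
      exact ⟨t, ht, convexHull_mono (by exact_mod_cast hst) hx⟩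
    · rintro ⟨t, ht, hx⟩
      refine ⟨t, ⟨⟨t, ht, subset_rfl⟩, ?_⟩, hx⟩
      rintro rfl
      simp at hx

/-! ### Circuits of four points and the construction of flips -/

/-- `μ` is an affine dependence of the points of `q`, signed so that its pairing with the heights
is positive. -/
structure IsCircuit (q : Finset Plane) (ω μ : Plane → ℝ) : Prop where
  sum_eq : ∑ p ∈ q, μ p = 0
  sum_smul_eq : ∑ p ∈ q, μ p • p = 0
  sum_pos : 0 < ∑ p ∈ q, μ p * ω p

theorem InGeneralPosition.exists_interpolation (hA : InGeneralPosition A) (ω : Plane → ℝ)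
    {t : Finset Plane} (ht : t ⊆ A) (h3 : t.card = 3) :
    ∃ ℓ : Plane →ᵃ[ℝ] ℝ, ∀ p ∈ t, ω p = ℓ p := by
  obtain ⟨a, b, c, hab, hac, hbc, rfl⟩ := Finset.card_eq_three.1 h3
  obtain ⟨B⟩ := hA.bary (ht (by simp)) (ht (by simp)) (ht (by simp)) hab hac hbc
  obtain ⟨ℓ, h1, h2, h3⟩ := B.exists_interpolation ω
  exact ⟨ℓ, by simp [h1, h2, h3]⟩

namespace IsCircuit

variable {q : Finset Plane} {ω μ : Plane → ℝ}

/-- An affine dependence annihilates `ℓ`, so the positive pairing with `ω` equals the pairing with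
`ω - ℓ`, of which only the term at `p` survives. -/
theorem mul_pos_of_interpolates (h : IsCircuit q ω μ) {p : Plane} (hp : p ∈ q)
    {ℓ : Plane →ᵃ[ℝ] ℝ} (hℓ : ∀ r ∈ q.erase p, ω r = ℓ r) : 0 < μ p * (ω p - ℓ p) := by
  have h0 : ∑ r ∈ q, μ r * ℓ r = 0 := by
    have := fun x => congrFun ℓ.decomp x
    simp only [Pi.add_apply] at this
    calc ∑ r ∈ q, μ r * ℓ r = ∑ r ∈ q, (ℓ.linear (μ r • r) + μ r * ℓ 0) :=
          Finset.sum_congr rfl fun r _ => by rw [this r, map_smul, smul_eq_mul]; ring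
      _ = 0 := by
          rw [Finset.sum_add_distrib, ← map_sum, h.sum_smul_eq, ← Finset.sum_mul, h.sum_eq]
          simp
  have h1 : ∑ r ∈ q, μ r * (ω r - ℓ r) = μ p * (ω p - ℓ p) :=
    Finset.sum_eq_single_of_mem p hp fun r hr hrp => by
      rw [hℓ r (Finset.mem_erase.2 ⟨hrp, hr⟩)]; ring
  rw [← h1]
  simp_rw [mul_sub]
  rw [Finset.sum_sub_distrib, h0, sub_zero]
  exact h.sum_pos

/-- By the previous lemma, the sign of `μ p` tells whether the lift of `p` is above or below the
opposite face. Upper faces thus omit points with negative coefficient, and lower faces points with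
positive coefficient. -/
theorem mem_extremeTriangles (h : IsCircuit q ω μ) (hq : InGeneralPosition q) (h4 : q.card = 4)
    (s : Dir) {t : Finset Plane} :
    t ∈ extremeTriangles q ω s ↔ ∃ p ∈ q, s.lt (μ p) 0 ∧ t = q.erase p := by
  constructor
  · rintro ⟨htq, h3, -, ℓ, hℓ, hlt⟩
    have hc : (q \ t).card = 1 := by rw [Finset.card_sdiff_of_subset htq]; omega
    obtain ⟨p, hp⟩ := Finset.card_eq_one.1 hc
    have hp' : p ∈ q \ t := by rw [hp]; simp
    rw [Finset.mem_sdiff] at hp'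
    have ht : t = q.erase p := by
      rw [Finset.erase_eq, ← hp, Finset.sdiff_sdiff_eq_self htq]
    refine ⟨p, hp'.1, ?_, ht⟩
    have h1 := h.mul_pos_of_interpolates hp'.1 (ht ▸ hℓ)
    have h2 := hlt p hp'.1 hp'.2
    cases s <;> simp only [Dir.lt] at h2 ⊢ <;> by_contra! hneg <;> nlinarith
  · rintro ⟨p, hp, hlt, rfl⟩
    have h3 : (q.erase p).card = 3 := by rw [Finset.card_erase_of_mem hp, h4]
    obtain ⟨ℓ, hℓ⟩ := hq.exists_interpolation ω (Finset.erase_subset p q) h3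
    refine ⟨Finset.erase_subset p q, h3, hq.affineIndependent_coe (Finset.erase_subset p q) h3, ℓ,
      hℓ, ?_⟩
    intro r hr hr'
    obtain rfl : r = p := by by_contra hne; exact hr' (Finset.mem_erase.2 ⟨hne, hr⟩)
    have h1 := h.mul_pos_of_interpolates hr hℓ
    cases s <;> simp only [Dir.lt] at hlt ⊢ <;> by_contra! hneg <;> nlinarith

theorem exists_lt (h : IsCircuit q ω μ) (s : Dir) : ∃ p ∈ q, s.lt (μ p) 0 := by
  by_contra! hcon
  have hz : ∀ p ∈ q, μ p = 0 := by
    cases s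
    · exact (Finset.sum_eq_zero_iff_of_nonneg fun p hp => not_lt.1 (hcon p hp)).1 h.sum_eq
    · exact (Finset.sum_eq_zero_iff_of_nonpos fun p hp => not_lt.1 (hcon p hp)).1 h.sum_eq
  have := h.sum_pos
  rw [Finset.sum_eq_zero fun p hp => by rw [hz p hp, zero_mul]] at this
  exact lt_irrefl _ this

end IsCircuit

/-- Adding a multiple `σ` of the dependence to the weights of `x` does not move `x`. Increase `σ`
until the first weight with negative `μ` reaches zero; this is the minimal ratio `w p / -μ p`. -/
theorem exists_mem_convexHull_erase {q : Finset Plane} {μ : Plane → ℝ} (h0 : ∑ p ∈ q, μ p = 0)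
    (h1 : ∑ p ∈ q, μ p • p = 0) (hex : ∃ p ∈ q, μ p < 0) {x : Plane}
    (hx : x ∈ convexHull ℝ (q : Set Plane)) :
    ∃ p ∈ q, μ p < 0 ∧ x ∈ convexHull ℝ ((q.erase p : Finset Plane) : Set Plane) := by
  obtain ⟨w, hw0, hw1, rfl⟩ := Finset.mem_convexHull'.1 hx
  obtain ⟨p, hp, hmin⟩ := Finset.exists_min_image (q.filter fun p => μ p < 0)
    (fun p => w p / -μ p) (by obtain ⟨p, hp, h⟩ := hex; exact ⟨p, by simp [hp, h]⟩)
  simp only [Finset.mem_filter] at hp hmin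
  obtain ⟨hp, hpneg⟩ := hp
  refine ⟨p, hp, hpneg, ?_⟩
  set σ := w p / -μ p with hσ
  have hσ0 : 0 ≤ σ := div_nonneg (hw0 p hp) (by linarith)
  have hp0 : w p + σ * μ p = 0 := by
    have := hpneg.ne
    rw [hσ]; field_simp; ring
  have hs : ∑ r ∈ q.erase p, (w r + σ * μ r) = 1 := by
    rw [Finset.sum_erase (f := fun r => w r + σ * μ r) _ hp0, Finset.sum_add_distrib, ← Finset.mul_sum, h0, hw1]; ring
  have hs' : ∑ r ∈ q.erase p, (w r + σ * μ r) • r = ∑ r ∈ q, w r • r := by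
    rw [Finset.sum_erase (f := fun r => (w r + σ * μ r) • r) _ (by rw [hp0, zero_smul])]
    simp_rw [add_smul, mul_smul]
    rw [Finset.sum_add_distrib, ← Finset.smul_sum, h1]; simp
  refine Finset.mem_convexHull'.2 ⟨fun r => w r + σ * μ r, ?_, hs, hs'⟩
  intro r hr
  have hr' := Finset.mem_of_mem_erase hr
  rcases lt_or_ge (μ r) 0 with hneg | hnn
  · have := hmin r ⟨hr', hneg⟩
    rw [le_div_iff₀ (by linarith)] at this
    linarith
  · have := hw0 r hr'
    positivity

theorem IsCircuit.exists_mem_convexHull {q : Finset Plane} {ω μ : Plane → ℝ}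
    (h : IsCircuit q ω μ) (hq : InGeneralPosition q) (h4 : q.card = 4) (s : Dir) {x : Plane}
    (hx : x ∈ convexHull ℝ (q : Set Plane)) :
    ∃ t ∈ extremeTriangles q ω s, x ∈ convexHull ℝ (t : Set Plane) := by
  have key : ∃ p ∈ q, s.lt (μ p) 0 ∧
      x ∈ convexHull ℝ ((q.erase p : Finset Plane) : Set Plane) := by
    cases s
    · exact exists_mem_convexHull_erase h.sum_eq h.sum_smul_eq (h.exists_lt .up) hx
    · have := exists_mem_convexHull_erase (μ := fun p => -μ p) (q := q)
        (by rw [Finset.sum_neg_distrib, h.sum_eq, neg_zero])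
        (by simp_rw [neg_smul]; rw [Finset.sum_neg_distrib, h.sum_smul_eq, neg_zero])
        (by simpa [Dir.lt] using h.exists_lt .down) hx
      simpa [Dir.lt] using this
  obtain ⟨p, hp, hlt, hx⟩ := key
  exact ⟨_, (h.mem_extremeTriangles hq h4 s).2 ⟨p, hp, hlt, rfl⟩, hx⟩

/-- Two extreme triangles meet in a common face. -/
theorem inter_subset_of_extremeTriangles {B : Finset Plane} {ω : Plane → ℝ}
    {t t' : Finset Plane} (ht : t ∈ extremeTriangles B ω .up)
    (ht' : t' ∈ extremeTriangles B ω .up) :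
    convexHull ℝ (t : Set Plane) ∩ convexHull ℝ (t' : Set Plane) ⊆
      convexHull ℝ ((t ∩ t' : Finset Plane) : Set Plane) := by
  obtain ⟨htB, -, -, ℓ, hℓ, hlt⟩ := ht
  obtain ⟨htB', -, -, ℓ', hℓ', hlt'⟩ := ht'
  rintro x ⟨hx, hx'⟩
  have hle : ∀ p ∈ B, ω p ≤ ℓ p := fun p hp => by
    by_cases h : p ∈ t
    · exact (hℓ p h).le
    · exact (hlt p hp h).le
  have hle' : ∀ p ∈ B, ω p ≤ ℓ' p := fun p hp => by
    by_cases h : p ∈ t'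
    · exact (hℓ' p h).le
    · exact (hlt' p hp h).le
  have hpos : ∀ p ∈ t, 0 ≤ (ℓ' - ℓ) p := fun p hp => by
    have := hle' p (htB hp)
    rw [hℓ p hp] at this
    simpa using this
  have h1 := le_of_mem_convexHull (ℓ' - ℓ) (m := 0) (fun p hp => hpos p hp) hx
  have h2 := le_of_mem_convexHull (ℓ - ℓ') (m := 0) (fun p hp => by
    have := hle p (htB' hp)
    rw [hℓ' p hp] at this
    simpa using this) hx'
  -- Both planes lie above all lifted points, so each is on or above the other over the opposite
  -- triangle. They agree at `x`, hence at the vertices of `t` carrying `x`, and these belong to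
  -- `t'` by strictness.
  have h0 : (ℓ' - ℓ) x = 0 := by
    simp at h1 h2 ⊢
    linarith
  refine convexHull_mono ?_ (mem_convexHull_filter_of_eq_zero _ hpos hx h0)
  intro p hp
  simp only [Finset.coe_filter, mem_ofPred_eq] at hp
  obtain ⟨hp, hp0⟩ := hp
  rw [Finset.mem_coe, Finset.mem_inter]
  refine ⟨hp, ?_⟩
  by_contra hn
  have h3 : ω p < ℓ' p := hlt' p (htB hp) hn
  have h4 := hℓ p hp
  simp at hp0
  linarith

/-- The points of a set in general position on a supporting line are affinely independent. -/
theorem affineIndependent_filter_eq (hA : InGeneralPosition A) {q : Finset Plane} (hq : q ⊆ A)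
    (ψ : Plane →ᵃ[ℝ] ℝ) {z : Plane} (hz : ψ z ≠ 0) :
    AffineIndependent ℝ ((↑) : (q.filter fun p => ψ p = 0 : Finset Plane) → Plane) := by
  set Z := q.filter fun p => ψ p = 0 with hZ
  have hc : Z.card ≤ 2 := by
    by_contra! hc
    obtain ⟨t, htZ, h3⟩ := Finset.exists_subset_card_eq (s := Z) (n := 3) (by omega)
    obtain ⟨a, b, c, hab, hac, hbc, rfl⟩ := Finset.card_eq_three.1 h3
    have hmem : ∀ p ∈ ({a, b, c} : Finset Plane), p ∈ A ∧ ψ p = 0 := fun p hp => by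
      have := htZ hp
      rw [hZ, Finset.mem_filter] at this
      exact ⟨hq this.1, this.2⟩
    obtain ⟨B⟩ := hA.bary (hmem a (by simp)).1 (hmem b (by simp)).1 (hmem c (by simp)).1 hab hac hbc
    apply hz
    rw [B.apply_eq ψ z, (hmem a (by simp)).2, (hmem b (by simp)).2, (hmem c (by simp)).2]
    ring
  have hcases : Z.card = 0 ∨ Z.card = 1 ∨ Z.card = 2 := by omega
  rcases hcases with h | h | h
  · have : IsEmpty Z := by
      rw [Finset.card_eq_zero.1 h]; infer_instance
    exact affineIndependent_of_subsingleton ℝ _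
  · obtain ⟨a, ha⟩ := Finset.card_eq_one.1 h
    have : Subsingleton Z := by rw [ha]; infer_instance
    exact affineIndependent_of_subsingleton ℝ _
  · obtain ⟨a, b, hab, hZab⟩ := Finset.card_eq_two.1 h
    have h2 := (affineIndependent_of_ne ℝ hab).range
    have hr : range ![a, b] = (Z : Set Plane) := by
      rw [hZab]; ext x
      simp [Matrix.range_cons, Matrix.range_empty, or_comm]
    rw [hr] at h2
    exact h2

/-- Hahn–Banach separates `x` from the interior, and the weak inequality passes to the closure. The
point `z` witnesses that `ψ` is not identically zero. -/
theorem exists_supporting {C : Set Plane} (hC : Convex ℝ C) (hne : (interior C).Nonempty)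
    {x : Plane} (hx : x ∉ interior C) :
    ∃ (ψ : Plane →ᵃ[ℝ] ℝ) (z : Plane), ψ z ≠ 0 ∧ ψ x = 0 ∧ ∀ p ∈ C, 0 ≤ ψ p := by
  obtain ⟨f, hf⟩ := geometric_hahn_banach_open_point hC.interior isOpen_interior hx
  obtain ⟨z, hz⟩ := hne
  let ψ : Plane →ᵃ[ℝ] ℝ := AffineMap.const ℝ Plane (f x) - (f : Plane →ₗ[ℝ] ℝ).toAffineMap
  have hψ : ∀ p, ψ p = f x - f p := fun p => by simp [ψ]
  refine ⟨ψ, z, ?_, by simp [hψ], ?_⟩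
  · rw [hψ]; have := hf z hz; linarith
  · intro p hp
    rw [hψ]
    have hcl : p ∈ closure (interior C) := by
      rw [hC.closure_interior_eq_closure_of_nonempty_interior ⟨z, hz⟩]
      exact subset_closure hp
    have : f p ≤ f x := by
      have hclosed : IsClosed {y | f y ≤ f x} := isClosed_le f.continuous continuous_const
      exact closure_minimal (fun y hy => (hf y hy).le) hclosed hcl
    linarith

/-- If the lower triangles of the tetrahedron over `q` are present, the up-flip at `q` exists. -/
theorem IsCircuit.exists_flip (hA : InGeneralPosition A) (hK : IsTriangulation A K)
    {q : Finset Plane} {ω μ : Plane → ℝ} (h : IsCircuit q ω μ) (hqA : q ⊆ A) (h4 : q.card = 4)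
    (hL : ∀ p ∈ q, 0 < μ p → q.erase p ∈ K.faces) : ∃ K', Flip A ω .up K K' := by
  have hq := hA.mono hqA
  set L := extremeTriangles q ω .down with hLdef
  set U := extremeTriangles q ω .up with hUdef
  have hLK : L ⊆ triangles K := by
    intro t ht
    obtain ⟨p, hp, hlt, rfl⟩ := (h.mem_extremeTriangles hq h4 .down).1 ht
    exact ⟨hL p hp hlt, by rw [Finset.card_erase_of_mem hp, h4]⟩
  have hsubq : ∀ {s} {t : Finset Plane}, t ∈ extremeTriangles q ω s →
      convexHull ℝ (t : Set Plane) ⊆ convexHull ℝ (q : Set Plane) :=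
    fun ht => convexHull_mono (by exact_mod_cast ht.1)
  have hneq : (interior (convexHull ℝ (q : Set Plane))).Nonempty := by
    obtain ⟨t, htq, h3⟩ := Finset.exists_subset_card_eq (s := q) (n := 3) (by omega)
    exact (interior_convexHull_nonempty hq htq h3).mono (interior_convexHull_mono htq)
  have hneA := hneq.mono (interior_convexHull_mono hqA)
  -- The lower triangles already fill `conv q`, so a remaining triangle that entered its interior
  -- would overlap one of them.
  have hdisj : ∀ t ∈ triangles K \ L, ∀ x ∈ convexHull ℝ (t : Set Plane),
      x ∉ interior (convexHull ℝ (q : Set Plane)) := by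
    rintro t ⟨ht, htL⟩ x hx hxq
    have hcl : x ∈ closure (interior (convexHull ℝ (t : Set Plane))) := by
      rw [(convex_convexHull ℝ _).closure_interior_eq_closure_of_nonempty_interior
        (interior_convexHull_nonempty hA (hK.subset ht.1) ht.2)]
      exact subset_closure hx
    obtain ⟨y, hyq, hyt⟩ := mem_closure_iff.1 hcl _ isOpen_interior hxq
    obtain ⟨t', ht', hyt'⟩ := h.exists_mem_convexHull hq h4 .down (interior_subset hyq)
    have hsub := hK.subset_of_mem_interior hA (hLK ht').1 ht hyt hyt'
    exact htL (Finset.eq_of_subset_of_card_le hsub (by rw [ht.2, ht'.2.1]) ▸ ht')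
  -- An old and a new triangle can meet only on the boundary of `conv q`. There a supporting line
  -- confines `x` to the hull of points of `q` on that line; general position leaves at most two of
  -- them, so they are affinely independent and the hulls intersect correctly.
  have hmixed : ∀ t ∈ triangles K \ L, ∀ t' ∈ U,
      convexHull ℝ (t : Set Plane) ∩ convexHull ℝ (t' : Set Plane) ⊆
      convexHull ℝ ((t ∩ t' : Finset Plane) : Set Plane) := by
    rintro t ht t' ht' x ⟨hx, hx'⟩
    obtain ⟨ψ, z, hz, hψx, hψ⟩ := exists_supporting (convex_convexHull ℝ (q : Set Plane)) hneq
      (hdisj t ht x hx)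
    have hxq := hsubq ht' hx'
    obtain ⟨t₁, ht₁, hx₁⟩ := h.exists_mem_convexHull hq h4 .down hxq
    have hx₂ := K.inter_subset_convexHull ht.1.1 (hLK ht₁).1 ⟨hx, hx₁⟩
    rw [← Finset.coe_inter] at hx₂
    have hψq : ∀ p ∈ q, 0 ≤ ψ p := fun p hp => hψ p (subset_convexHull ℝ _ hp)
    have hsub₂ : t ∩ t₁ ⊆ q := Finset.inter_subset_right.trans ht₁.1
    have e₁ := mem_convexHull_filter_of_eq_zero ψ (fun p hp => hψq p (hsub₂ hp)) hx₂ hψx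
    have e₂ := mem_convexHull_filter_of_eq_zero ψ (fun p hp => hψq p (ht'.1 hp)) hx' hψx
    have e₃ := (affineIndependent_filter_eq hA hqA ψ hz).convexHull_inter
      (Finset.filter_subset_filter _ hsub₂) (Finset.filter_subset_filter _ ht'.1)
    have e₄ := e₃.symm.subset ⟨e₁, e₂⟩
    refine convexHull_mono ?_ e₄
    rintro p ⟨hp, hp'⟩
    simp only [Finset.coe_filter, Finset.mem_inter, mem_ofPred_eq] at hp hp'
    rw [Finset.mem_coe, Finset.mem_inter]
    exact ⟨hp.1.1, hp'.1⟩
  obtain ⟨K', htri, hvert, hspace⟩ := exists_complex_of_triangles hA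
    (𝒯 := (triangles K \ L) ∪ U)
    (by
      rintro t (ht | ht)
      · exact hK.subset ht.1.1
      · exact ht.1.trans hqA)
    (by
      rintro t (ht | ht)
      · exact ht.1.2
      · exact ht.2.1)
    (by
      rintro t (ht | ht) t' (ht' | ht')
      · rw [Finset.coe_inter]
        exact K.inter_subset_convexHull ht.1.1 ht'.1.1
      · exact hmixed t ht t' ht'
      · rw [inter_comm, Finset.inter_comm]
        exact hmixed t' ht' t ht
      · exact inter_subset_of_extremeTriangles ht ht')
  refine ⟨K', hK, ⟨hvert, ?_⟩, q, hqA, h4, hLK, ?_, ?_⟩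
  · rw [hspace]
    apply Subset.antisymm
    · refine iUnion₂_subset ?_
      rintro t (ht | ht)
      · exact hK.convexHull_subset ht.1.1
      · exact convexHull_mono (by exact_mod_cast ht.1.trans hqA)
    · intro x hx
      obtain ⟨t, ht, hxt⟩ := hK.exists_triangle hneA hx
      by_cases htL : t ∈ L
      · obtain ⟨t', ht', hx'⟩ := h.exists_mem_convexHull hq h4 .up (hsubq htL hxt)
        exact mem_biUnion (Or.inr ht') hx'
      · exact mem_biUnion (Or.inl ⟨ht, htL⟩) hxt
  · rw [htri]; exact subset_union_right
  · rw [htri]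
    change triangles K \ L = ((triangles K \ L) ∪ U) \ U
    rw [union_sdiff_right, eq_comm, sdiff_eq_left, Set.disjoint_left]
    intro t ht htU
    obtain ⟨x, hx⟩ := interior_convexHull_nonempty hA (hK.subset ht.1.1) ht.1.2
    exact hdisj t ht x (interior_subset hx) (interior_mono (hsubq htU) hx)

variable {ω : Plane → ℝ}

/-- The dependence expresses `d` in barycentric coordinates. With coefficient 1 at `d`, its pairing
with the heights is `ω d - ℓ d`. -/
theorem Bary.exists_circuit {a b c d : Plane} (B : Bary a b c) (hab : a ≠ b) (hac : a ≠ c)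
    (had : a ≠ d) (hbc : b ≠ c) (hbd : b ≠ d) (hcd : c ≠ d) {ℓ : Plane →ᵃ[ℝ] ℝ} (ha : ω a = ℓ a)
    (hb : ω b = ℓ b) (hc : ω c = ℓ c) (hd : ℓ d < ω d) :
    ∃ μ, IsCircuit {a, b, c, d} ω μ ∧ μ a = -B.u d ∧ μ b = -B.v d ∧ μ c = -B.w d ∧ μ d = 1 := by
  let μ : Plane → ℝ := fun p =>
    if p = a then -B.u d else if p = b then -B.v d else if p = c then -B.w d else 1
  have h1 : μ a = -B.u d := by simp [μ]
  have h2 : μ b = -B.v d := by simp [μ, hab.symm]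
  have h3 : μ c = -B.w d := by simp [μ, hac.symm, hbc.symm]
  have h4 : μ d = 1 := by simp [μ, had.symm, hbd.symm, hcd.symm]
  have hsum : ∀ {M : Type} [AddCommMonoid M] (f : Plane → M),
      ∑ p ∈ ({a, b, c, d} : Finset Plane), f p = f a + (f b + (f c + f d)) := by
    intro M _ f
    rw [Finset.sum_insert (by simp [hab, hac, had]), Finset.sum_insert (by simp [hbc, hbd]),
      Finset.sum_insert (by simp [hcd]), Finset.sum_singleton]
  refine ⟨μ, ⟨?_, ?_, ?_⟩, h1, h2, h3, h4⟩
  · rw [hsum, h1, h2, h3, h4]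
    linarith [B.sum_eq d]
  · rw [hsum, h1, h2, h3, h4]
    have := B.comb_eq d
    nth_rewrite 4 [this]
    module
  · rw [hsum, h1, h2, h3, h4, ha, hb, hc]
    have := B.apply_eq ℓ d
    linarith

/-- The signs of the coordinates of `d` determine which faces besides `abc` are lower, so 2-2, 1-3
and 3-1 flips are handled together. -/
theorem exists_flip_of_faces (hA : InGeneralPosition A) (hK : IsTriangulation A K)
    {a b c d : Plane} (haA : a ∈ A) (hbA : b ∈ A) (hcA : c ∈ A) (hdA : d ∈ A)
    (B : Bary a b c) (hab : a ≠ b) (hac : a ≠ c)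
    (had : a ≠ d) (hbc : b ≠ c) (hbd : b ≠ d) (hcd : c ≠ d) {ℓ : Plane →ᵃ[ℝ] ℝ} (ha : ω a = ℓ a)
    (hb : ω b = ℓ b) (hc : ω c = ℓ c) (hd : ℓ d < ω d) (habc : {a, b, c} ∈ K.faces)
    (hu : B.u d < 0 → {b, c, d} ∈ K.faces) (hv : B.v d < 0 → {a, c, d} ∈ K.faces)
    (hw : B.w d < 0 → {a, b, d} ∈ K.faces) : ∃ K', Flip A ω .up K K' := by
  obtain ⟨μ, hμ, h1, h2, h3, h4⟩ := B.exists_circuit hab hac had hbc hbd hcd ha hb hc hd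
  refine hμ.exists_flip hA hK (by simp [Finset.insert_subset_iff, *]) ?_ ?_
  · rw [Finset.card_insert_of_notMem (by simp [hab, hac, had]),
      Finset.card_insert_of_notMem (by simp [hbc, hbd]),
      Finset.card_insert_of_notMem (by simp [hcd]), Finset.card_singleton]
  · intro p hp hpos
    simp only [Finset.mem_insert, Finset.mem_singleton] at hp
    rcases hp with rfl | rfl | rfl | rfl
    · convert! hu (by linarith) using 1
      ext x; simp only [Finset.mem_erase, Finset.mem_insert, Finset.mem_singleton]; grind
    · convert! hv (by linarith) using 1
      ext x; simp only [Finset.mem_erase, Finset.mem_insert, Finset.mem_singleton]; grind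
    · convert! hw (by linarith) using 1
      ext x; simp only [Finset.mem_erase, Finset.mem_insert, Finset.mem_singleton]; grind
    · convert! habc using 1
      ext x; simp only [Finset.mem_erase, Finset.mem_insert, Finset.mem_singleton]; grind

/-! ### Hinges and folded edges -/

/-- The edge `ab` of `K` is shared by the two triangles `abc` and `abd`. -/
structure Hinge (K : SimplicialComplex ℝ Plane) (a b c d : Plane) : Prop where
  left : {a, b, c} ∈ K.faces
  right : {a, b, d} ∈ K.faces
  ab : a ≠ b
  ac : a ≠ c
  ad : a ≠ d
  bc : b ≠ c
  bd : b ≠ d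
  cd : c ≠ d

theorem areApexes_iff {a b c d : Plane} (hab : a ≠ b) :
    AreApexes K {a, b} c d ↔ Hinge K a b c d := by
  have hface : ∀ c : Plane, (∃ f ∈ K.faces, (f : Set Plane) =
      insert c ((({a, b} : Finset Plane)) : Set Plane)) ↔ {a, b, c} ∈ K.faces := by
    intro c
    have he : insert c ((({a, b} : Finset Plane)) : Set Plane) =
        (({a, b, c} : Finset Plane) : Set Plane) := by
      ext x; simp; tauto
    rw [he]
    constructor
    · rintro ⟨f, hf, hfe⟩
      rwa [Finset.coe_injective hfe] at hf
    · exact fun h => ⟨_, h, rfl⟩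
  unfold AreApexes
  rw [hface, hface]
  simp only [Finset.mem_insert, Finset.mem_singleton, not_or]
  constructor
  · rintro ⟨-, -, ⟨h1, h2⟩, ⟨h3, h4⟩, h5, h6, h7⟩
    exact ⟨h6, h7, hab, Ne.symm h1, Ne.symm h3, Ne.symm h2, Ne.symm h4, h5⟩
  · intro h
    refine ⟨K.down_closed h.left ?_ (by simp), Finset.card_pair hab, ⟨h.ac.symm, h.bc.symm⟩,
      ⟨h.ad.symm, h.bd.symm⟩, h.cd, h.left, h.right⟩
    intro x; simp; tauto

namespace Hinge

variable {a b c d : Plane}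

theorem swap_edge (h : Hinge K a b c d) : Hinge K b a c d :=
  ⟨Finset.insert_comm a b _ ▸ h.left, Finset.insert_comm a b _ ▸ h.right, h.ab.symm, h.bc, h.bd,
    h.ac, h.ad, h.cd⟩

theorem swap_apex (h : Hinge K a b c d) : Hinge K a b d c :=
  ⟨h.right, h.left, h.ab, h.ad, h.ac, h.bd, h.bc, h.cd.symm⟩

theorem mem_a (hK : IsTriangulation A K) (h : Hinge K a b c d) : a ∈ A :=
  hK.subset h.left (by simp)

theorem mem_b (hK : IsTriangulation A K) (h : Hinge K a b c d) : b ∈ A :=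
  hK.subset h.left (by simp)

theorem mem_c (hK : IsTriangulation A K) (h : Hinge K a b c d) : c ∈ A :=
  hK.subset h.left (by simp)

theorem mem_d (hK : IsTriangulation A K) (h : Hinge K a b c d) : d ∈ A :=
  hK.subset h.right (by simp)

theorem bary (hA : InGeneralPosition A) (hK : IsTriangulation A K) (h : Hinge K a b c d) :
    Nonempty (Bary a b c) :=
  hA.bary (h.mem_a hK) (h.mem_b hK) (h.mem_c hK) h.ab h.ac h.bc

end Hinge

/-- Otherwise `B.w` would vanish on the whole triangle `abe`, hence on the plane, contradicting its
value 1 at `c`. -/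
theorem Bary.w_ne_zero {a b c e : Plane} (B : Bary a b c) (B' : Bary a b e) : B.w e ≠ 0 := by
  intro h
  have := B'.apply_eq B.w c
  rw [B.wa, B.wb, B.wc, h] at this
  simp at this

theorem card_triple {a b c : Plane} (hab : a ≠ b) (hac : a ≠ c) (hbc : b ≠ c) :
    ({a, b, c} : Finset Plane).card = 3 :=
  Finset.card_eq_three.2 ⟨a, b, c, hab, hac, hbc, rfl⟩

theorem coe_triple (a b c : Plane) :
    (({a, b, c} : Finset Plane) : Set Plane) = {a, b, c} := by simp

/-- Two triangles on the same side of a common edge coincide. -/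
theorem apex_eq_of_same_side (hA : InGeneralPosition A) (hK : IsTriangulation A K)
    {a b c e : Plane} (hc : {a, b, c} ∈ K.faces) (he : {a, b, e} ∈ K.faces) (hab : a ≠ b)
    (hac : a ≠ c) (hbc : b ≠ c) (B : Bary a b c) (hpos : 0 < B.w e) : e = c := by
  set α := B.u e with hα
  set β := B.v e with hβ
  set D := 2 * (1 + |α| + |β|) with hD
  have hD0 : 0 < D := by positivity
  -- The factor makes `ε * (1 + |α| + |β|) = 1 / 2`, so that moving from the midpoint of `ab`
  -- towards `e` keeps the coordinates at `a` and `b` positive.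
  set ε := 1 / D with hε
  have hε0 : 0 < ε := by positivity
  have hεD : ε * D = 1 := by rw [hε]; field_simp
  have hε1 : ε ≤ 1 := by
    have := abs_nonneg α; have := abs_nonneg β; nlinarith
  set z : Plane := ((1 - ε) / 2) • a + ((1 - ε) / 2) • b + ε • e with hz
  have hs : (1 - ε) / 2 + (1 - ε) / 2 + ε = 1 := by ring
  have hz1 : z ∈ interior (convexHull ℝ (({a, b, c} : Finset Plane) : Set Plane)) := by
    rw [coe_triple, B.mem_interior, hz, affineMap_comb_three _ hs, affineMap_comb_three _ hs,
      affineMap_comb_three _ hs, B.ua, B.ub, B.va, B.vb, B.wa, B.wb, ← hα, ← hβ]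
    have h1 := neg_abs_le α
    have h2 := neg_abs_le β
    have h3 := abs_nonneg α
    have h4 := abs_nonneg β
    refine ⟨?_, ?_, ?_⟩
    · nlinarith [mul_nonneg hε0.le h3, mul_nonneg hε0.le h4, mul_le_mul_of_nonneg_left h1 hε0.le]
    · nlinarith [mul_nonneg hε0.le h3, mul_nonneg hε0.le h4, mul_le_mul_of_nonneg_left h2 hε0.le]
    · simpa using mul_pos hε0 hpos
  have hz2 : z ∈ convexHull ℝ (({a, b, e} : Finset Plane) : Set Plane) := by
    rw [coe_triple, mem_convexHull_triple]
    exact ⟨_, _, _, by linarith, by linarith, hε0.le, hs, rfl⟩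
  have := hK.subset_of_mem_interior hA he ⟨hc, card_triple hab hac hbc⟩ hz1 hz2
    (show c ∈ ({a, b, c} : Finset Plane) by simp)
  simp only [Finset.mem_insert, Finset.mem_singleton] at this
  rcases this with h | h | h
  · exact absurd h.symm hac
  · exact absurd h.symm hbc
  · exact h.symm

namespace Hinge

variable {a b c d : Plane}

theorem opposite (hA : InGeneralPosition A) (hK : IsTriangulation A K) (h : Hinge K a b c d)
    (B : Bary a b c) : B.w d < 0 := by
  obtain ⟨B'⟩ := h.swap_apex.bary hA hK
  rcases lt_trichotomy (B.w d) 0 with h1 | h1 | h1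
  · exact h1
  · exact absurd h1 (B.w_ne_zero B')
  · exact absurd (apex_eq_of_same_side hA hK h.left h.right h.ab h.ac h.bc B h1).symm h.cd

/-- The apexes `c` and `d` are on opposite sides of `ab`, and `e` shares a side with one of them. -/
theorem eq_or_eq (hA : InGeneralPosition A) (hK : IsTriangulation A K) (h : Hinge K a b c d)
    {e : Plane} (he : {a, b, e} ∈ K.faces) (hae : a ≠ e) (hbe : b ≠ e) : e = c ∨ e = d := by
  obtain ⟨B⟩ := h.bary hA hK
  obtain ⟨B'⟩ := h.swap_apex.bary hA hK
  obtain ⟨B''⟩ := hA.bary (h.mem_a hK) (h.mem_b hK) (hK.subset he (by simp)) h.ab hae hbe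
  rcases lt_trichotomy (B.w e) 0 with h1 | h1 | h1
  · right
    have h2 := B'.apply_eq B.w e
    rw [B.wa, B.wb] at h2
    have h3 := h.opposite hA hK B
    refine apex_eq_of_same_side hA hK h.right he h.ab h.ad h.bd B' ?_
    by_contra! hneg
    nlinarith
  · exact absurd h1 (B.w_ne_zero B'')
  · exact Or.inl (apex_eq_of_same_side hA hK h.left he h.ab h.ac h.bc B h1)

end Hinge

/-- The edge `ab`, shared by the triangles `abc` and `abd` of `K`, is folded upwards by the
lifting. -/
structure ConvexHinge (K : SimplicialComplex ℝ Plane) (ω : Plane → ℝ) (a b c d : Plane) : Prop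
    extends Hinge K a b c d where
  above : ∃ ℓ : Plane →ᵃ[ℝ] ℝ, ω a = ℓ a ∧ ω b = ℓ b ∧ ω c = ℓ c ∧ ℓ d < ω d

theorem isLocallyNonRegular_up_iff {a b : Plane} (hab : a ≠ b) :
    IsLocallyNonRegular ω .up K {a, b} ↔ ∃ c d, ConvexHinge K ω a b c d := by
  unfold IsLocallyNonRegular
  simp only [areApexes_iff hab, Finset.mem_insert, Finset.mem_singleton, forall_eq_or_imp,
    forall_eq, Dir.lt]
  constructor
  · rintro ⟨c, d, h, ℓ, ⟨h1, h2⟩, h3, h4⟩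
    exact ⟨c, d, h, ℓ, h1, h2, h3, h4⟩
  · rintro ⟨c, d, h, ℓ, h1, h2, h3, h4⟩
    exact ⟨c, d, h, ℓ, ⟨h1, h2⟩, h3, h4⟩

namespace ConvexHinge

variable {a b c d : Plane}

theorem swap_edge (h : ConvexHinge K ω a b c d) : ConvexHinge K ω b a c d := by
  obtain ⟨ℓ, h1, h2, h3⟩ := h.above
  exact ⟨h.toHinge.swap_edge, ℓ, h2, h1, h3⟩

/-- The two planes agree along `ab`, so their difference at `d` is `B.w d` times that at `c`, and
`B.w d` is negative. -/
theorem swap_apex (hA : InGeneralPosition A) (hK : IsTriangulation A K)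
    (h : ConvexHinge K ω a b c d) : ConvexHinge K ω a b d c := by
  obtain ⟨ℓ, h1, h2, h3, h4⟩ := h.above
  obtain ⟨B⟩ := h.bary hA hK
  obtain ⟨B'⟩ := h.toHinge.swap_apex.bary hA hK
  obtain ⟨ℓ', e1, e2, e3⟩ := B'.exists_interpolation ω
  refine ⟨h.toHinge.swap_apex, ℓ', e1.symm, e2.symm, e3.symm, ?_⟩
  have f1 := B.apply_eq (ℓ' - ℓ) d
  have f2 := h.opposite hA hK B
  simp only [AffineMap.coe_sub, Pi.sub_apply] at f1
  rw [e1, e2, e3, ← h1, ← h2] at f1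
  rw [h3]
  by_contra! hneg
  nlinarith

end ConvexHinge

/-! ### Reflex endpoints of folded edges -/

/-- The convex hinge at the edge `ab` is not a convex quadrilateral: its reflex vertex is `a`. -/
structure ReflexHinge (K : SimplicialComplex ℝ Plane) (ω : Plane → ℝ) (a b c d : Plane) : Prop
    extends ConvexHinge K ω a b c d where
  reflex : a ∈ interior (convexHull ℝ ({b, c, d} : Set Plane))

/-- `a` is the reflex endpoint of a locally non-regular edge `ab`. -/
def ReflexAt (K : SimplicialComplex ℝ Plane) (ω : Plane → ℝ) (b a : Plane) : Prop :=
  ∃ c d, ReflexHinge K ω a b c d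

theorem ReflexHinge.swap_apex (hA : InGeneralPosition A) (hK : IsTriangulation A K)
    {a b c d : Plane} (h : ReflexHinge K ω a b c d) : ReflexHinge K ω a b d c :=
  ⟨h.toConvexHinge.swap_apex hA hK, by rw [pair_comm]; exact h.reflex⟩

theorem Hinge.bary_reflex (hA : InGeneralPosition A) (hK : IsTriangulation A K) {a b c d : Plane}
    (h : Hinge K a b c d) : Nonempty (Bary b c d) :=
  hA.bary (h.mem_b hK) (h.mem_c hK) (h.mem_d hK) h.bc h.bd h.cd

/-- With `v` and `w` negative at `d`, solving the barycentric expression of `d` for `a` gives a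
convex combination of `b`, `c`, `d` with positive weights. -/
theorem ConvexHinge.reflexHinge_of_neg (hA : InGeneralPosition A) (hK : IsTriangulation A K)
    {a b c d : Plane} (h : ConvexHinge K ω a b c d) (B : Bary a b c) (hv : B.v d < 0) :
    ReflexHinge K ω a b c d := by
  refine ⟨h, ?_⟩
  have hw := h.opposite hA hK B
  have hs := B.sum_eq d
  obtain ⟨B'⟩ := h.bary_reflex hA hK
  have hu : 0 < B.u d := by linarith
  have e1 := B.apply_eq B'.u d
  have e2 := B.apply_eq B'.v d
  have e3 := B.apply_eq B'.w d
  rw [B'.ua, B'.ub, B'.uc] at e1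
  rw [B'.va, B'.vb, B'.vc] at e2
  rw [B'.wa, B'.wb, B'.wc] at e3
  rw [B'.mem_interior]
  refine ⟨?_, ?_, ?_⟩ <;> by_contra! hneg <;> nlinarith

/-- If neither endpoint is reflex, only the coordinate of `d` at `c` is negative, so `abc` and `abd`
are all the lower faces and a 2-2 flip exists. -/
theorem ConvexHinge.reflexAt_of_noFlip (hA : InGeneralPosition A) (hK : IsTriangulation A K)
    (hno : NoFlip A ω .up K) {a b c d : Plane} (h : ConvexHinge K ω a b c d) :
    ReflexAt K ω b a ∨ ReflexAt K ω a b := by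
  obtain ⟨B⟩ := h.bary hA hK
  obtain ⟨B₂⟩ := h.swap_edge.bary hA hK
  rcases lt_or_ge (B.v d) 0 with hv | hv
  · exact Or.inl ⟨c, d, h.reflexHinge_of_neg hA hK B hv⟩
  rcases lt_or_ge (B.u d) 0 with hu | hu
  · refine Or.inr ⟨c, d, h.swap_edge.reflexHinge_of_neg hA hK B₂ ?_⟩
    have := B.apply_eq B₂.v d
    rw [B₂.va, B₂.vb, B₂.vc] at this
    linarith
  obtain ⟨ℓ, h1, h2, h3, h4⟩ := h.above
  exact absurd (exists_flip_of_faces hA hK (h.mem_a hK) (h.mem_b hK) (h.mem_c hK) (h.mem_d hK) B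
    h.ab h.ac h.ad h.bc h.bd h.cd h1 h2 h3 h4 h.left (fun hn => absurd hu hn.not_ge)
    (fun hn => absurd hv hn.not_ge) (fun _ => h.right)) hno

theorem ReflexHinge.exists_bary_pos (hA : InGeneralPosition A) (hK : IsTriangulation A K)
    {a b c d : Plane} (h : ReflexHinge K ω a b c d) :
    ∃ β γ δ : ℝ, 0 < β ∧ 0 < γ ∧ 0 < δ ∧ β + γ + δ = 1 ∧ a = β • b + γ • c + δ • d := by
  obtain ⟨B⟩ := h.bary_reflex hA hK
  obtain ⟨h1, h2, h3⟩ := (B.mem_interior a).1 h.reflex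
  exact ⟨_, _, _, h1, h2, h3, B.sum_eq a, B.comb_eq a⟩

theorem ReflexHinge.isInterior (hK : IsTriangulation A K) {a b c d : Plane}
    (h : ReflexHinge K ω a b c d) : IsInterior A a := by
  refine ⟨h.mem_a hK, interior_mono (convexHull_mono ?_) h.reflex⟩
  simp [insert_subset_iff, h.mem_b hK, h.mem_c hK, h.mem_d hK]

/-- If an upper extreme triangle used `a`, its plane minus the plane over `abc` would be nonnegative
at `b` and `c`, positive at `d`, and zero at their positive combination `a`. -/
theorem ReflexAt.isRedundant (hA : InGeneralPosition A) (hK : IsTriangulation A K) {a b : Plane}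
    (h : ReflexAt K ω b a) : IsRedundant A ω .up K a := by
  obtain ⟨c, d, h⟩ := h
  refine ⟨IsTriangulation.mem_vertices_of_mem h.left (by simp), h.isInterior hK, ?_⟩
  rintro ⟨-, t, ⟨htA, -, -, ℓ', hℓ', hlt⟩, hat⟩
  have hle : ∀ p ∈ A, ω p ≤ ℓ' p := fun p hp => by
    by_cases hpt : p ∈ t
    · exact (hℓ' p hpt).le
    · exact (hlt p hp hpt).le
  obtain ⟨ℓ, h1, h2, h3, h4⟩ := h.above
  obtain ⟨β, γ, δ, hβ, hγ, hδ, hs, ha⟩ := h.exists_bary_pos hA hK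
  have e1 := affineMap_comb_three (ℓ' - ℓ) hs b c d
  rw [← ha] at e1
  simp only [AffineMap.coe_sub, Pi.sub_apply] at e1
  have hb := hle b (h.mem_b hK)
  have hc := hle c (h.mem_c hK)
  have hd := hle d (h.mem_d hK)
  have haa := hℓ' a hat
  have f1 : 0 ≤ β * (ℓ' b - ℓ b) := mul_nonneg hβ.le (by linarith)
  have f2 : 0 ≤ γ * (ℓ' c - ℓ c) := mul_nonneg hγ.le (by linarith)
  have f3 : 0 < δ * (ℓ' d - ℓ d) := mul_pos hδ (by linarith)
  linarith

/-- The reflex vertex of a hinge is interior to every convex set containing the other vertices. -/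
theorem ReflexHinge.mem_interior_of_mem {C : Set Plane} (hC : Convex ℝ C) {a b c d : Plane}
    (h : ReflexHinge K ω a b c d) (hb : b ∈ C) (hc : c ∈ C) (hd : d ∈ C) : a ∈ interior C :=
  interior_mono (convexHull_min (by simp [insert_subset_iff, hb, hc, hd]) hC) h.reflex

/-- Both hinges have the same apexes. If `b` were reflex too, it would be interior to `conv {b, c,
d}`, which contains `a` and the apexes but has `b` as a vertex. -/
theorem ReflexAt.asymm (hA : InGeneralPosition A) (hK : IsTriangulation A K) {a b : Plane}
    (h : ReflexAt K ω b a) : ¬ ReflexAt K ω a b := by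
  obtain ⟨c, d, h⟩ := h
  rintro ⟨c', d', h'⟩
  obtain ⟨B⟩ := h.bary_reflex hA hK
  have hC := convex_convexHull ℝ ({b, c, d} : Set Plane)
  have hmem : ∀ e ∈ ({c, d} : Set Plane), e ∈ convexHull ℝ ({b, c, d} : Set Plane) :=
    fun e he => subset_convexHull ℝ _ (mem_insert_of_mem _ he)
  refine B.not_mem_interior_left (h'.mem_interior_of_mem hC (interior_subset h.reflex) ?_ ?_)
  · exact hmem _ (h.eq_or_eq hA hK h'.toHinge.swap_edge.left h'.bc h'.ac)
  · exact hmem _ (h.eq_or_eq hA hK h'.toHinge.swap_edge.right h'.bd h'.ad)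

/-! ### The piecewise linear lift and its concavity along segments -/

variable {f : Plane → ℝ}

/-- `f` is the piecewise linear interpolation of the heights on the triangles of `K`. -/
def IsLift (K : SimplicialComplex ℝ Plane) (ω f : Plane → ℝ) : Prop :=
  ∀ t ∈ triangles K, ∀ ℓ : Plane →ᵃ[ℝ] ℝ, (∀ p ∈ t, ω p = ℓ p) →
    ∀ x ∈ convexHull ℝ (t : Set Plane), f x = ℓ x

theorem exists_isLift (hA : InGeneralPosition A) (hK : IsTriangulation A K) (ω : Plane → ℝ) :
    ∃ f, IsLift K ω f := by
  have hint : ∀ t ∈ triangles K, ∃ ℓ : Plane →ᵃ[ℝ] ℝ, ∀ p ∈ t, ω p = ℓ p :=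
    fun t ht => hA.exists_interpolation ω (hK.subset ht.1) ht.2
  choose! L hL using hint
  refine ⟨fun x => if h : ∃ t ∈ triangles K, x ∈ convexHull ℝ (t : Set Plane) then
    L h.choose x else 0, ?_⟩
  intro t ht ℓ hℓ x hx
  have h : ∃ t ∈ triangles K, x ∈ convexHull ℝ (t : Set Plane) := ⟨t, ht, hx⟩
  obtain ⟨h1, h2⟩ := h.choose_spec
  simp only [h, dif_pos]
  refine eq_of_mem_convexHull _ _ ?_ (K.inter_subset_convexHull h1.1 ht.1 ⟨h2, hx⟩)
  rintro p ⟨hp, hp'⟩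
  rw [← hL _ h1 p hp, hℓ p hp']

theorem IsLift.apply_vertex (hf : IsLift K ω f) (hA : InGeneralPosition A)
    (hK : IsTriangulation A K) {t : Finset Plane} (ht : t ∈ triangles K) {p : Plane}
    (hp : p ∈ t) : f p = ω p := by
  obtain ⟨ℓ, hℓ⟩ := hA.exists_interpolation ω (hK.subset ht.1) ht.2
  rw [hf t ht ℓ hℓ p (subset_convexHull ℝ _ hp), hℓ p hp]

theorem IsLift.continuousOn (hf : IsLift K ω f) (hA : InGeneralPosition A)
    (hK : IsTriangulation A K) (hne : (interior (convexHull ℝ (A : Set Plane))).Nonempty) :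
    ContinuousOn f (convexHull ℝ (A : Set Plane)) := by
  have hfin : Finite (triangles K) := (hK.finite_faces.subset fun t ht => ht.1 :
    (triangles K).Finite).to_subtype
  have h := (locallyFinite_of_finite
    (fun t : triangles K => convexHull ℝ ((t : Finset Plane) : Set Plane))).continuousOn_iUnion
    (g := f) (fun t => isClosed_convexHull_finset _) (by
      rintro ⟨t, ht⟩
      obtain ⟨ℓ, hℓ⟩ := hA.exists_interpolation ω (hK.subset ht.1) ht.2
      exact (affineMap_continuous ℓ).continuousOn.congr (hf t ht ℓ hℓ))
  refine h.mono fun x hx => ?_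
  obtain ⟨t, ht, hxt⟩ := hK.exists_triangle hne hx
  exact mem_iUnion.2 ⟨⟨t, ht⟩, hxt⟩

/-- Faces that come close to a point contain it. -/
theorem IsTriangulation.eventually_mem_face (hK : IsTriangulation A K) (x : Plane) :
    ∀ᶠ y in 𝓝 x, ∀ s ∈ K.faces, y ∈ convexHull ℝ (s : Set Plane) →
      x ∈ convexHull ℝ (s : Set Plane) := by
  rw [Filter.eventually_all_finite hK.finite_faces]
  intro s _
  by_cases hx : x ∈ convexHull ℝ (s : Set Plane)
  · exact Filter.Eventually.of_forall fun _ _ => hx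
  · filter_upwards [(isClosed_convexHull_finset s).isOpen_compl.mem_nhds hx] with y hy h
    exact absurd h hy

theorem exists_eq_triple {t : Finset Plane} (h3 : t.card = 3) {a b : Plane} (hab : a ≠ b)
    (ha : a ∈ t) (hb : b ∈ t) : ∃ d, a ≠ d ∧ b ≠ d ∧ t = {a, b, d} := by
  have hsub : ({a, b} : Finset Plane) ⊆ t := by simp [Finset.insert_subset_iff, ha, hb]
  have hc : (t \ {a, b}).card = 1 := by
    rw [Finset.card_sdiff_of_subset hsub, Finset.card_pair hab, h3]
  obtain ⟨d, hd⟩ := Finset.card_eq_one.1 hc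
  have hd' : d ∈ t \ {a, b} := by rw [hd]; simp
  simp only [Finset.mem_sdiff, Finset.mem_insert, Finset.mem_singleton, not_or] at hd'
  refine ⟨d, Ne.symm hd'.2.1, Ne.symm hd'.2.2, ?_⟩
  rw [← Finset.sdiff_union_of_subset hsub, hd]
  ext x; simp; tauto

/-- A face meeting the relative interior of an edge contains the edge. -/
theorem IsTriangulation.pair_subset_of_mem {a b c x : Plane} (B : Bary a b c)
    (habK : {a, b} ∈ K.faces) {α β : ℝ} (hα : 0 < α) (hβ : 0 < β) (hs : α + β = 1)
    (hx : x = α • a + β • b) {s : Finset Plane} (hsK : s ∈ K.faces)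
    (hxs : x ∈ convexHull ℝ (s : Set Plane)) : a ∈ s ∧ b ∈ s := by
  have hxab : x ∈ convexHull ℝ (({a, b} : Finset Plane) : Set Plane) := by
    rw [Finset.coe_pair, convexHull_pair, hx]
    exact ⟨α, β, hα.le, hβ.le, hs, rfl⟩
  have h := K.inter_subset_convexHull habK hsK ⟨hxab, hxs⟩
  constructor
  · by_contra hn
    have h0 := eq_of_mem_convexHull B.u 0 (fun p hp => by
      obtain ⟨hp, hp'⟩ := hp
      simp only [Finset.coe_pair, mem_insert_iff, mem_singleton_iff] at hp
      rcases hp with rfl | rfl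
      · exact absurd hp' hn
      · simp [B.ub]) h
    rw [hx, affineMap_comb_two _ hs, B.ua, B.ub] at h0
    simp at h0
    exact hα.ne' h0
  · by_contra hn
    have h0 := eq_of_mem_convexHull B.v 0 (fun p hp => by
      obtain ⟨hp, hp'⟩ := hp
      simp only [Finset.coe_pair, mem_insert_iff, mem_singleton_iff] at hp
      rcases hp with rfl | rfl
      · simp [B.va]
      · exact absurd hp' hn) h
    rw [hx, affineMap_comb_two _ hs, B.va, B.vb] at h0
    simp at h0
    exact hβ.ne' h0

theorem pair_mem_faces {a b c : Plane} (h : {a, b, c} ∈ K.faces) : {a, b} ∈ K.faces :=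
  K.down_closed h (by intro x; simp; tauto) (by simp)

/-- An edge that passes through the interior of the convex hull is shared by two triangles. -/
theorem IsTriangulation.exists_hinge (hA : InGeneralPosition A) (hK : IsTriangulation A K)
    {a b c x : Plane} (hab : a ≠ b) (hac : a ≠ c) (hbc : b ≠ c) (hT : {a, b, c} ∈ K.faces)
    {α β : ℝ} (hα : 0 < α) (hβ : 0 < β) (hs : α + β = 1) (hx : x = α • a + β • b)
    (hxA : x ∈ interior (convexHull ℝ (A : Set Plane))) : ∃ d, Hinge K a b c d := by
  obtain ⟨B⟩ := hA.bary (hK.subset hT (by simp)) (hK.subset hT (by simp))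
    (hK.subset hT (by simp)) hab hac hbc
  -- Step from `x` slightly away from `c`. The triangle found there contains the edge by closeness,
  -- and its third vertex is not `c` because the `c`-coordinate of the new point is negative.
  have hpath : Filter.Tendsto (fun ε : ℝ => x - ε • (c - x)) (𝓝[>] 0) (𝓝 x) := by
    have : ContinuousAt (fun ε : ℝ => x - ε • (c - x)) 0 := by fun_prop
    have h := this.tendsto
    simp only [zero_smul, sub_zero] at h
    exact h.mono_left nhdsWithin_le_nhds
  have hev := hpath.eventually ((hK.eventually_mem_face x).and
    (isOpen_interior.mem_nhds hxA))
  obtain ⟨ε, ⟨h1, h2⟩, hε⟩ := (hev.and self_mem_nhdsWithin).exists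
  have hε : 0 < ε := hε
  obtain ⟨t, ht, hyt⟩ := hK.exists_triangle ⟨x, hxA⟩ (interior_subset h2)
  have hxt := h1 t ht.1 hyt
  obtain ⟨hat, hbt⟩ := pair_subset_of_mem B (pair_mem_faces hT) hα hβ hs hx ht.1 hxt
  obtain ⟨d, had, hbd, rfl⟩ := exists_eq_triple ht.2 hab hat hbt
  refine ⟨d, hT, ht.1, hab, hac, had, hbc, hbd, ?_⟩
  rintro rfl
  have hw : B.w (x - ε • (c - x)) = -ε := by
    have e : x - ε • (c - x) = ((1 + ε) * α) • a + ((1 + ε) * β) • b + (-ε) • c := by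
      rw [hx]; module
    rw [e]
    exact (B.coords_comb (by linear_combination (1 + ε) * hs)).2.2
  rw [coe_triple, B.mem_convexHull, hw] at hyt
  linarith [hyt.2.2]

/-- Local concavity of the lift at a point of an edge that is not folded upwards. -/
theorem IsLift.exists_support_edge (hf : IsLift K ω f) (hA : InGeneralPosition A)
    (hK : IsTriangulation A K) {a b c x : Plane} (hab : a ≠ b) (hac : a ≠ c) (hbc : b ≠ c)
    (hT : {a, b, c} ∈ K.faces) {α β : ℝ} (hα : 0 < α) (hβ : 0 < β) (hs : α + β = 1)
    (hx : x = α • a + β • b) (hxA : x ∈ interior (convexHull ℝ (A : Set Plane)))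
    (hreg : ∀ c d, ¬ ConvexHinge K ω a b c d) :
    ∃ ℓ : Plane →ᵃ[ℝ] ℝ, f x = ℓ x ∧ ∀ᶠ y in 𝓝 x, f y ≤ ℓ y := by
  obtain ⟨d, h⟩ := hK.exists_hinge hA hab hac hbc hT hα hβ hs hx hxA
  obtain ⟨B⟩ := h.bary hA hK
  obtain ⟨B'⟩ := h.swap_apex.bary hA hK
  obtain ⟨ℓ, e1, e2, e3⟩ := B.exists_interpolation ω
  obtain ⟨ℓ', e1', e2', e3'⟩ := B'.exists_interpolation ω
  have hle : ω d ≤ ℓ d := by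
    by_contra! hlt
    exact hreg c d ⟨h, ℓ, e1.symm, e2.symm, e3.symm, hlt⟩
  have htri : ∀ e, a ≠ e → b ≠ e → {a, b, e} ∈ K.faces → {a, b, e} ∈ triangles K :=
    fun e hae hbe he => ⟨he, card_triple hab hae hbe⟩
  have hfl := hf _ (htri c hac hbc hT) ℓ (by simp [e1, e2, e3])
  have hfl' := hf _ (htri d h.ad h.bd h.right) ℓ' (by simp [e1', e2', e3'])
  refine ⟨ℓ, hfl x ?_, ?_⟩
  · rw [coe_triple, mem_convexHull_triple]
    exact ⟨α, β, 0, hα.le, hβ.le, le_rfl, by linarith, by rw [hx]; simp⟩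
  · filter_upwards [hK.eventually_mem_face x, isOpen_interior.mem_nhds hxA] with y hy hyA
    obtain ⟨t, ht, hyt⟩ := hK.exists_triangle ⟨x, hxA⟩ (interior_subset hyA)
    have hxt := hy t ht.1 hyt
    obtain ⟨hat, hbt⟩ :=
      IsTriangulation.pair_subset_of_mem B (pair_mem_faces hT) hα hβ hs hx ht.1 hxt
    obtain ⟨e, hae, hbe, rfl⟩ := exists_eq_triple ht.2 hab hat hbt
    rcases h.eq_or_eq hA hK ht.1 hae hbe with rfl | rfl
    · exact (hfl y hyt).le
    · rw [hfl' y hyt]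
      have := le_of_mem_convexHull (ℓ - ℓ') (m := 0) (fun p hp => by
        simp only [Finset.coe_insert, Finset.coe_singleton, mem_insert_iff,
          mem_singleton_iff] at hp
        rcases hp with rfl | rfl | rfl <;> simp [*]) hyt
      simpa using this

/-- A point at which the lift of `K` is locally concave. -/
structure IsRegularPoint (A : Finset Plane) (K : SimplicialComplex ℝ Plane) (ω : Plane → ℝ)
    (x : Plane) : Prop where
  mem_interior : x ∈ interior (convexHull ℝ (A : Set Plane))
  not_vertex : x ∉ K.vertices
  not_hinge : ∀ a b c d, ∀ α β : ℝ, 0 < α → 0 < β → α + β = 1 → x = α • a + β • b →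
    ¬ ConvexHinge K ω a b c d

/-- A regular point lies inside a triangle, where the lift is affine, or inside an edge, which by
regularity is not folded. -/
theorem IsLift.exists_support (hf : IsLift K ω f) (hA : InGeneralPosition A)
    (hK : IsTriangulation A K) {x : Plane} (hx : IsRegularPoint A K ω x) :
    ∃ ℓ : Plane →ᵃ[ℝ] ℝ, f x = ℓ x ∧ ∀ᶠ y in 𝓝 x, f y ≤ ℓ y := by
  obtain ⟨t, ht, hxt⟩ := hK.exists_triangle ⟨x, hx.1⟩ (interior_subset hx.1)
  obtain ⟨a, b, c, hab, hac, hbc, rfl⟩ := Finset.card_eq_three.1 ht.2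
  have hT := ht.1
  have hvert : ∀ p ∈ ({a, b, c} : Finset Plane), x ≠ p := by
    rintro p hp rfl
    exact hx.2 (IsTriangulation.mem_vertices_of_mem hT hp)
  obtain ⟨B⟩ := hA.bary (hK.subset hT (by simp)) (hK.subset hT (by simp))
    (hK.subset hT (by simp)) hab hac hbc
  have hedge : ∀ {a b c : Plane}, a ≠ b → a ≠ c → b ≠ c → {a, b, c} ∈ K.faces → x ≠ a → x ≠ b →
      ∀ α β : ℝ, 0 ≤ α → 0 ≤ β → α + β = 1 → x = α • a + β • b →
      ∃ ℓ : Plane →ᵃ[ℝ] ℝ, f x = ℓ x ∧ ∀ᶠ y in 𝓝 x, f y ≤ ℓ y := by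
    intro a b c hab hac hbc hT hxa hxb α β hα hβ hs hxe
    have hα' : 0 < α := by
      refine hα.lt_of_ne ?_
      rintro rfl
      obtain rfl : β = 1 := by linarith
      exact hxb (by simpa using hxe)
    have hβ' : 0 < β := by
      refine hβ.lt_of_ne ?_
      rintro rfl
      obtain rfl : α = 1 := by linarith
      exact hxa (by simpa using hxe)
    exact hf.exists_support_edge hA hK hab hac hbc hT hα' hβ' hs hxe hx.1
      fun c d => hx.3 a b c d α β hα' hβ' hs hxe
  have hxt' := hxt
  rw [coe_triple, B.mem_convexHull] at hxt
  obtain ⟨h1, h2, h3⟩ := hxt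
  have hsum := B.sum_eq x
  have hcomb := B.comb_eq x
  rcases h1.eq_or_lt with h1 | h1
  · rw [← h1] at hsum hcomb
    refine hedge hbc hab.symm hac.symm ?_ (hvert b (by simp)) (hvert c (by simp)) _ _ h2 h3
      (by linarith) (by simpa using hcomb)
    convert! hT using 1
    ext p; simp; tauto
  rcases h2.eq_or_lt with h2 | h2
  · rw [← h2] at hsum hcomb
    refine hedge hac hab hbc.symm ?_ (hvert a (by simp)) (hvert c (by simp)) _ _ h1.le h3
      (by linarith) (by simpa using hcomb)
    convert! hT using 1
    ext p; simp; tauto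
  rcases h3.eq_or_lt with h3 | h3
  · rw [← h3] at hsum hcomb
    exact hedge hab hac hbc hT (hvert a (by simp)) (hvert b (by simp)) _ _ h1.le h2.le
      (by linarith) (by simpa using hcomb)
  obtain ⟨ℓ, hℓ⟩ := hA.exists_interpolation ω (hK.subset hT) ht.2
  have hfl := hf _ ht ℓ hℓ
  refine ⟨ℓ, hfl x hxt', ?_⟩
  have hint : x ∈ interior (convexHull ℝ (({a, b, c} : Finset Plane) : Set Plane)) := by
    rw [coe_triple, B.mem_interior]; exact ⟨h1, h2, h3⟩
  filter_upwards [isOpen_interior.mem_nhds hint] with y hy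
  exact (hfl y (interior_subset hy)).le

/-- A function on an interval that has local upper supports is nonnegative if it is so at the
endpoints. -/
theorem nonneg_of_local_support {g : ℝ → ℝ} (hg : ContinuousOn g (Icc 0 1)) (h0 : 0 ≤ g 0)
    (h1 : 0 ≤ g 1)
    (hsup : ∀ t ∈ Ioo (0 : ℝ) 1, ∃ m : ℝ, ∀ᶠ s in 𝓝 t, g s ≤ g t + m * (s - t)) :
    ∀ t ∈ Icc (0 : ℝ) 1, 0 ≤ g t := by
  obtain ⟨t₀, ht₀, hmin⟩ := isCompact_Icc.exists_isMinOn (nonempty_Icc.2 zero_le_one) hg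
  have hmin' : ∀ t ∈ Icc (0 : ℝ) 1, g t₀ ≤ g t := fun t ht => hmin ht
  by_contra! hcon
  obtain ⟨t, ht, htneg⟩ := hcon
  have hneg : g t₀ < 0 := (hmin' t ht).trans_lt htneg
  set M := Icc (0 : ℝ) 1 ∩ g ⁻¹' {g t₀} with hM
  have hMc : IsClosed M := hg.preimage_isClosed_of_isClosed isClosed_Icc isClosed_singleton
  have hMcomp : IsCompact M := isCompact_Icc.of_isClosed_subset hMc inter_subset_left
  -- Take the last minimiser `t₁`. The slope terms at `t₁ ± ε / 2` cancel, so both values equal the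
  -- minimum, contradicting the choice of `t₁`.
  obtain ⟨t₁, ht₁, hmax⟩ := hMcomp.exists_isGreatest ⟨t₀, ht₀, rfl⟩
  have hgt₁ : g t₁ = g t₀ := ht₁.2
  have hIoo : t₁ ∈ Ioo (0 : ℝ) 1 := by
    refine ⟨ht₁.1.1.lt_of_ne ?_, ht₁.1.2.lt_of_ne ?_⟩
    · rintro rfl; linarith
    · rintro rfl; linarith
  obtain ⟨m, hm⟩ := hsup t₁ hIoo
  have hev := hm.and (isOpen_Ioo.mem_nhds hIoo)
  obtain ⟨ε, hε, hball⟩ := Metric.eventually_nhds_iff.1 hev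
  have hr := hball (y := t₁ + ε / 2) (by
    rw [Real.dist_eq, abs_lt]; constructor <;> linarith)
  have hl := hball (y := t₁ - ε / 2) (by
    rw [Real.dist_eq, abs_lt]; constructor <;> linarith)
  have a1 := hmin' _ (Ioo_subset_Icc_self hr.2)
  have a2 := hmin' _ (Ioo_subset_Icc_self hl.2)
  have hle : g (t₁ + ε / 2) = g t₀ := by nlinarith [hr.1, hl.1]
  have := hmax ⟨Ioo_subset_Icc_self hr.2, hle⟩
  linarith

/-- The lift is concave along segments of regular points. -/
theorem IsLift.chord_le (hf : IsLift K ω f) (hA : InGeneralPosition A)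
    (hK : IsTriangulation A K) (hne : (interior (convexHull ℝ (A : Set Plane))).Nonempty)
    {p q : Plane} (hp : p ∈ convexHull ℝ (A : Set Plane)) (hq : q ∈ convexHull ℝ (A : Set Plane))
    (hreg : ∀ s ∈ Ioo (0 : ℝ) 1, IsRegularPoint A K ω ((1 - s) • p + s • q)) {s : ℝ}
    (hs : s ∈ Icc (0 : ℝ) 1) : (1 - s) * f p + s * f q ≤ f ((1 - s) • p + s • q) := by
  have hcont : ContinuousOn (fun s : ℝ => f ((1 - s) • p + s • q) - ((1 - s) * f p + s * f q))
      (Icc 0 1) := by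
    refine ContinuousOn.sub ?_ (by fun_prop)
    refine (hf.continuousOn hA hK hne).comp (by fun_prop) ?_
    intro s hs
    exact convex_convexHull ℝ _ hp hq (by linarith [hs.2]) hs.1 (by ring)
  have := nonneg_of_local_support hcont (by simp) (by simp) ?_ s hs
  · linarith
  intro t ht
  obtain ⟨ℓ, h1, h2⟩ := hf.exists_support hA hK (hreg t ht)
  refine ⟨ℓ q - ℓ p - (f q - f p), ?_⟩
  have hc : ContinuousAt (fun s : ℝ => (1 - s) • p + s • q) t := by fun_prop
  filter_upwards [hc.eventually h2] with s hs
  have e : ∀ r : ℝ, ℓ ((1 - r) • p + r • q) = (1 - r) * ℓ p + r * ℓ q :=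
    fun r => affineMap_comb_two ℓ (by ring) p q
  rw [e] at hs h1
  rw [h1]
  linarith

/-! ### The star of a reflex vertex and the outgoing folded edge -/

/-- A neighbour of `a` in the cone of a triangle at `a` is a vertex of that triangle. -/
theorem eq_or_eq_of_mem_cone {a p u v : Plane} (hp : {a, p} ∈ K.faces) (hT : {a, u, v} ∈ K.faces)
    (hap : a ≠ p) {σ τ : ℝ} (hσ : 0 ≤ σ) (hτ : 0 ≤ τ)
    (h : p = (1 - σ - τ) • a + σ • u + τ • v) : p = u ∨ p = v := by
  by_contra! hne
  set ε := 1 / (1 + σ + τ) with hε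
  have hD : 0 < 1 + σ + τ := by positivity
  have hε0 : 0 < ε := by positivity
  have hεD : ε * (1 + σ + τ) = 1 := by rw [hε]; field_simp
  set z : Plane := (1 - ε) • a + ε • p with hz
  have h1 : z ∈ convexHull ℝ (({a, p} : Finset Plane) : Set Plane) := by
    rw [Finset.coe_pair, convexHull_pair]
    exact ⟨1 - ε, ε, by nlinarith, hε0.le, by ring, rfl⟩
  have h2 : z ∈ convexHull ℝ (({a, u, v} : Finset Plane) : Set Plane) := by
    rw [coe_triple, mem_convexHull_triple]
    refine ⟨1 - ε * σ - ε * τ, ε * σ, ε * τ, by nlinarith, by positivity, by positivity, by ring, ?_⟩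
    rw [hz, h]
    module
  have h3 := K.inter_subset_convexHull hp hT ⟨h1, h2⟩
  have h4 : (({a, p} : Finset Plane) : Set Plane) ∩ (({a, u, v} : Finset Plane) : Set Plane) ⊆
      {a} := by
    rintro x ⟨hx, hx'⟩
    simp only [Finset.coe_pair, coe_triple, mem_insert_iff, mem_singleton_iff] at hx hx' ⊢
    grind
  have h5 := convexHull_mono h4 h3
  rw [convexHull_singleton, mem_singleton_iff, hz] at h5
  have h6 : ε • (p - a) = 0 := by
    rw [← sub_eq_zero.2 h5]; module
  rcases smul_eq_zero.1 h6 with h7 | h7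
  · exact hε0.ne' h7
  · exact hap (sub_eq_zero.1 h7).symm

/-- The cones at an interior point of a triangle cover the plane. -/
theorem Bary.exists_cone {b c d a : Plane} (B : Bary b c d) {β γ δ : ℝ} (hβ : 0 < β) (hγ : 0 < γ)
    (hδ : 0 < δ) (hs : β + γ + δ = 1) (ha : a = β • b + γ • c + δ • d) (p : Plane) :
    ∃ σ τ : ℝ, 0 ≤ σ ∧ 0 ≤ τ ∧ (p = (1 - σ - τ) • a + σ • b + τ • c ∨
      p = (1 - σ - τ) • a + σ • b + τ • d ∨ p = (1 - σ - τ) • a + σ • c + τ • d) := by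
  have hsum := B.sum_eq p
  have hp := B.comb_eq p
  set U := B.u p
  set V := B.v p
  set W := B.w p
  -- Trade `r` copies of `a` for its combination of `b`, `c`, `d`. Taking `r` as the least of `U /
  -- β`, `V / γ`, `W / δ` kills one coefficient and keeps the other two nonnegative.
  have key : ∀ r : ℝ, p = (U - r * β) • b + (V - r * γ) • c + (W - r * δ) • d + r • a := by
    intro r
    rw [ha]
    conv_lhs => rw [hp]
    module
  have hr : ∀ r, 1 - r = (U - r * β) + (V - r * γ) + (W - r * δ) := fun r => by
    linear_combination r * hs - hsum
  by_cases h1 : U / β ≤ V / γ ∧ U / β ≤ W / δ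
  · have e1 : U - U / β * β = 0 := by field_simp; ring
    have e2 : 0 ≤ V - U / β * γ := by linarith [(le_div_iff₀ hγ).1 h1.1]
    have e3 : 0 ≤ W - U / β * δ := by linarith [(le_div_iff₀ hδ).1 h1.2]
    refine ⟨_, _, e2, e3, Or.inr (Or.inr ?_)⟩
    have h := key (U / β)
    have h' := hr (U / β)
    rw [e1] at h h'
    rw [show 1 - (V - U / β * γ) - (W - U / β * δ) = U / β by linarith]
    conv_lhs => rw [h]
    module
  by_cases h2 : V / γ ≤ W / δ
  · have h3 : V / γ ≤ U / β := by
      by_contra! h; exact h1 ⟨h.le, h.le.trans h2⟩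
    have e1 : V - V / γ * γ = 0 := by field_simp; ring
    have e2 : 0 ≤ U - V / γ * β := by linarith [(le_div_iff₀ hβ).1 h3]
    have e3 : 0 ≤ W - V / γ * δ := by linarith [(le_div_iff₀ hδ).1 h2]
    refine ⟨_, _, e2, e3, Or.inr (Or.inl ?_)⟩
    have h := key (V / γ)
    have h' := hr (V / γ)
    rw [e1] at h h'
    rw [show 1 - (U - V / γ * β) - (W - V / γ * δ) = V / γ by linarith]
    conv_lhs => rw [h]
    module
  · push Not at h2
    have h3 : W / δ ≤ U / β := by
      by_contra! h; exact h1 ⟨(h.trans h2).le, h.le⟩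
    have e1 : W - W / δ * δ = 0 := by field_simp; ring
    have e2 : 0 ≤ U - W / δ * β := by linarith [(le_div_iff₀ hβ).1 h3]
    have e3 : 0 ≤ V - W / δ * γ := by linarith [(le_div_iff₀ hγ).1 h2.le]
    refine ⟨_, _, e2, e3, Or.inl ?_⟩
    have h := key (W / δ)
    have h' := hr (W / δ)
    rw [e1] at h h'
    rw [show 1 - (U - W / δ * β) - (V - W / δ * γ) = W / δ by linarith]
    conv_lhs => rw [h]
    module

/-- Edges with the same reflex endpoint `a` are edges of the hinge at `a`. -/
theorem ReflexHinge.eq_of_reflexHinge (hA : InGeneralPosition A) (hK : IsTriangulation A K)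
    {a b c d e e₁ e₂ : Plane} (h : ReflexHinge K ω a b c d) (he : ReflexHinge K ω a e e₁ e₂) :
    e = b ∨ e = c ∨ e = d := by
  by_contra! hne
  obtain ⟨hneb, hnec, hned⟩ := hne
  obtain ⟨B₀⟩ := h.bary_reflex hA hK
  obtain ⟨B⟩ := hA.bary (h.mem_a hK) (h.mem_c hK) (h.mem_d hK) h.ac h.ad h.cd
  obtain ⟨β, γ, δ, hβ, hγ, hδ, hs, ha⟩ := h.exists_bary_pos hA hK
  -- The triangles `abc` and `abd` occupy their cones, so every neighbour of `a` except `b` lies in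
  -- the closed cone at `a` spanned by `c` and `d`. Then `e`, `e₁`, `e₂` all lie in this pointed
  -- cone and cannot surround its apex `a`.
  have cone : ∀ p, a ≠ p → {a, p} ∈ K.faces → p ≠ b → 0 ≤ B.v p ∧ 0 ≤ B.w p := by
    intro p hap hp hpb
    obtain ⟨σ, τ, hσ, hτ, h1 | h1 | h1⟩ := B₀.exists_cone hβ hγ hδ hs ha p
    · rcases eq_or_eq_of_mem_cone hp h.left hap hσ hτ h1 with h2 | h2
      · exact absurd h2 hpb
      · rw [h2, B.vb, B.wb]; simp
    · rcases eq_or_eq_of_mem_cone hp h.right hap hσ hτ h1 with h2 | h2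
      · exact absurd h2 hpb
      · rw [h2, B.vc, B.wc]; simp
    · obtain ⟨-, h2, h3⟩ := B.coords_comb (α := 1 - σ - τ) (β := σ) (γ := τ) (by ring)
      rw [h1, h2, h3]
      exact ⟨hσ, hτ⟩
  have apex : ∀ p, a ≠ p → {a, e, p} ∈ K.faces → 0 ≤ B.v p ∧ 0 ≤ B.w p := by
    intro p hap hp
    refine cone p hap (K.down_closed hp (by intro x; simp; tauto) (by simp)) ?_
    rintro rfl
    rcases h.eq_or_eq hA hK (e := e) (by rwa [Finset.pair_comm]) he.ab (Ne.symm hneb) with h1 | h1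
    · exact hnec h1
    · exact hned h1
  obtain ⟨p0, p0'⟩ := cone e he.ab (pair_mem_faces he.left) hneb
  obtain ⟨p1, p1'⟩ := apex e₁ he.ac he.left
  obtain ⟨p2, p2'⟩ := apex e₂ he.ad he.right
  obtain ⟨α₀, α₁, α₂, g0, g1, g2, gs, hae⟩ := he.exists_bary_pos hA hK
  have f1 := affineMap_comb_three B.v gs e e₁ e₂
  have f2 := affineMap_comb_three B.w gs e e₁ e₂
  rw [← hae, B.va] at f1
  rw [← hae, B.wa] at f2
  have z1 : B.v e = 0 := by nlinarith [mul_nonneg g0.le p0, mul_nonneg g1.le p1, mul_nonneg g2.le p2]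
  have z2 : B.w e = 0 := by
    nlinarith [mul_nonneg g0.le p0', mul_nonneg g1.le p1', mul_nonneg g2.le p2']
  have hsum := B.sum_eq e
  have hcomb := B.comb_eq e
  rw [z1, z2] at hsum hcomb
  have z3 : B.u e = 1 := by linarith
  rw [z3] at hcomb
  exact he.ab (by simpa using hcomb.symm)

/-- Points close to an interior vertex `a` and off the folded edges at `a` are regular. -/
theorem IsTriangulation.exists_ball_regular (hK : IsTriangulation A K) {a : Plane}
    (ha : a ∈ K.vertices) (haA : a ∈ interior (convexHull ℝ (A : Set Plane))) (ω : Plane → ℝ) :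
    ∃ r > 0, Metric.ball a r ⊆ convexHull ℝ (A : Set Plane) ∧ ∀ z ∈ Metric.ball a r, z ≠ a →
      (∀ e c d, ConvexHinge K ω a e c d → ∀ τ : ℝ, 0 < τ → z ≠ (1 - τ) • a + τ • e) →
      IsRegularPoint A K ω z := by
  obtain ⟨r, hr, hball⟩ := Metric.eventually_nhds_iff_ball.1
    ((hK.eventually_mem_face a).and (isOpen_interior.mem_nhds haA))
  refine ⟨r, hr, fun z hz => interior_subset (hball z hz).2, ?_⟩
  intro z hz hza hray
  have hface : ∀ s ∈ K.faces, z ∈ convexHull ℝ (s : Set Plane) → a ∈ s := fun s hs hzs =>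
    (SimplicialComplex.vertex_mem_convexHull_iff ha hs).1 ((hball z hz).1 s hs hzs)
  refine ⟨(hball z hz).2, ?_, ?_⟩
  · intro hzv
    have := hface {z} hzv (by simp)
    exact hza (Finset.mem_singleton.1 this).symm
  · intro u v c d α β hα hβ hs hz h
    have hm := hface {u, v} (pair_mem_faces h.left) (by
      rw [Finset.coe_pair, convexHull_pair, hz]
      exact ⟨α, β, hα.le, hβ.le, hs, rfl⟩)
    simp only [Finset.mem_insert, Finset.mem_singleton] at hm
    rcases hm with rfl | rfl
    · exact hray v c d h β hβ (by rw [hz, ← hs]; module)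
    · exact hray u c d h.swap_edge α hα (by rw [hz, ← hs]; module)

/-- If every folded edge at the reflex vertex `a` belongs to the hinge `ab`, then `ac` is folded. -/
theorem ReflexHinge.exists_convexHinge (hA : InGeneralPosition A) (hK : IsTriangulation A K)
    {a b c d : Plane} (h : ReflexHinge K ω a b c d)
    (honly : ∀ e c' d', ConvexHinge K ω a e c' d' → e = b ∨ e = c ∨ e = d) :
    ∃ c' d', ConvexHinge K ω a c c' d' := by
  by_contra! hnc
  obtain ⟨f, hf⟩ := exists_isLift hA hK ω
  have hint := (h.isInterior hK).2
  obtain ⟨r, hr, hrA, hreg⟩ := hK.exists_ball_regular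
    (IsTriangulation.mem_vertices_of_mem h.left (by simp)) hint ω
  obtain ⟨B⟩ := h.bary hA hK
  obtain ⟨B₂⟩ := hA.bary (h.mem_a hK) (h.mem_c hK) (h.mem_d hK) h.ac h.ad h.cd
  obtain ⟨β, γ, δ, hβ, hγ, hδ, hs, ha⟩ := h.exists_bary_pos hA hK
  obtain ⟨ℓ, e1, e2, e3, e4⟩ := h.above
  have hball : ∀ p : Plane, ∀ᶠ τ : ℝ in 𝓝[>] 0, (1 - τ) • a + τ • p ∈ Metric.ball a r := by
    intro p
    have : ContinuousAt (fun τ : ℝ => (1 - τ) • a + τ • p) 0 := by fun_prop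
    have h2 := this.tendsto
    simp only [sub_zero, one_smul, zero_smul, add_zero] at h2
    exact (h2.mono_left nhdsWithin_le_nhds).eventually (Metric.ball_mem_nhds a hr)
  -- The bound `1 / 2` keeps the `a`-coordinate `1 - 2 * τ` of the later point `y` positive.
  obtain ⟨τ, ⟨⟨⟨hcB, hdB⟩, hyB⟩, hτ1⟩, hτ0⟩ := ((((hball c).and (hball d)).and
    (hball (b + c - a))).and (nhdsWithin_le_nhds (gt_mem_nhds (show (0 : ℝ) < 1 / 2 by norm_num)))
    |>.and self_mem_nhdsWithin).exists
  have hτ0 : 0 < τ := hτ0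
  set ct := (1 - τ) • a + τ • c with hct
  set dt := (1 - τ) • a + τ • d with hdt
  have hconv := convex_ball a r
  have hb1 : B₂.v b < 0 := by
    have := affineMap_comb_three B₂.v hs b c d
    rw [← ha, B₂.va, B₂.vb, B₂.vc] at this
    by_contra! hn
    nlinarith
  -- The open segment runs inside the cone of `c` and `d`, away from the rays towards `b`, `c` and
  -- `d`, so no folded edge is met and the lift is concave along it.
  have hseg : ∀ s ∈ Ioo (0 : ℝ) 1, IsRegularPoint A K ω ((1 - s) • ct + s • dt) := by
    rintro s ⟨hs0, hs1⟩
    have hz : (1 - s) • ct + s • dt = (1 - τ) • a + (τ * (1 - s)) • c + (τ * s) • d := by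
      rw [hct, hdt]; module
    have hco := B₂.coords_comb (α := 1 - τ) (β := τ * (1 - s)) (γ := τ * s) (by ring)
    rw [← hz] at hco
    have hv : 0 < B₂.v ((1 - s) • ct + s • dt) := by
      rw [hco.2.1]; exact mul_pos hτ0 (by linarith)
    have hw : 0 < B₂.w ((1 - s) • ct + s • dt) := by
      rw [hco.2.2]; exact mul_pos hτ0 hs0
    refine hreg _ (hconv hcB hdB (by linarith) hs0.le (by ring)) ?_ ?_
    · intro heq
      rw [heq, B₂.va] at hv
      exact lt_irrefl _ hv
    · intro e c' d' he σ hσ heq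
      rw [heq, affineMap_comb_two _ (by ring), B₂.va] at hv
      rw [heq, affineMap_comb_two _ (by ring), B₂.wa] at hw
      rcases honly e c' d' he with rfl | rfl | rfl
      · nlinarith
      · rw [B₂.wb] at hw; simp at hw
      · rw [B₂.vc] at hv; simp at hv
  have hne : (interior (convexHull ℝ (A : Set Plane))).Nonempty := ⟨a, hint⟩
  -- With these weights `x` lies on the line `ab`, beyond `a`. Concavity lifts it strictly above the
  -- plane `ℓ` of `abc`, since the lift is on `ℓ` at `ct` and above it at `dt`.
  set s := δ / (γ + δ) with hsdef
  have hγδ : 0 < γ + δ := by linarith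
  have hs0 : 0 < s := by positivity
  have hs1 : s < 1 := by rw [hsdef, div_lt_one hγδ]; linarith
  set x := (1 - s) • ct + s • dt with hx
  have hchord := hf.chord_le hA hK hne (hrA hcB) (hrA hdB) hseg (s := s) ⟨hs0.le, hs1.le⟩
  have hflc : ∀ z ∈ convexHull ℝ (({a, b, c} : Finset Plane) : Set Plane), f z = ℓ z :=
    hf _ ⟨h.left, card_triple h.ab h.ac h.bc⟩ ℓ (by simp [e1, e2, e3])
  have hfct : f ct = ℓ ct := by
    refine hflc ct ?_
    rw [coe_triple, mem_convexHull_triple]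
    exact ⟨1 - τ, 0, τ, by linarith, le_rfl, hτ0.le, by ring, by rw [hct]; simp⟩
  have hfdt : ℓ dt < f dt := by
    obtain ⟨B'⟩ := h.toHinge.swap_apex.bary hA hK
    obtain ⟨ℓ', g1, g2, g3⟩ := B'.exists_interpolation ω
    have := hf _ ⟨h.right, card_triple h.ab h.ad h.bd⟩ ℓ' (by simp [g1, g2, g3]) dt (by
      rw [coe_triple, mem_convexHull_triple]
      exact ⟨1 - τ, 0, τ, by linarith, le_rfl, hτ0.le, by ring, by rw [hdt]; simp⟩)
    rw [this, hdt, affineMap_comb_two _ (by ring), affineMap_comb_two _ (by ring), g1, g3, ← e1]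
    nlinarith
  have hfx : ℓ x < f x := by
    refine lt_of_lt_of_le ?_ hchord
    rw [hx, affineMap_comb_two _ (by ring), hfct]
    nlinarith
  have hxB : x ∈ Metric.ball a r := hconv hcB hdB (by linarith) hs0.le (by ring)
  have hxw : B.w x = 0 := by
    have hd0 : B.w d = -γ / δ := by
      have := affineMap_comb_three B.w hs b c d
      rw [← ha, B.wa, B.wb, B.wc] at this
      field_simp
      linarith
    rw [hx, affineMap_comb_two _ (by ring), hct, hdt, affineMap_comb_two _ (by ring),
      affineMap_comb_two _ (by ring), B.wa, B.wc, hd0, hsdef]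
    field_simp
    ring
  set y := (1 - τ) • a + τ • (b + c - a) with hy
  have hyc : y = (1 - 2 * τ) • a + τ • b + τ • c := by rw [hy]; module
  have hyco := B.coords_comb (α := 1 - 2 * τ) (β := τ) (γ := τ) (by ring)
  rw [← hyc] at hyco
  have hyint : y ∈ interior (convexHull ℝ (({a, b, c} : Finset Plane) : Set Plane)) := by
    rw [coe_triple, B.mem_interior, hyco.1, hyco.2.1, hyco.2.2]
    exact ⟨by linarith [show τ < 1 / 2 from hτ1], hτ0, hτ0⟩
  -- The segment from `y`, inside `abc`, to `x` stays on the side of `c`, where only `ac` could be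
  -- folded. Concavity along it, with equality to `ℓ` near `y`, puts the lift at `x` on or below
  -- `ℓ`, a contradiction.
  have hseg' : ∀ s ∈ Ioo (0 : ℝ) 1, IsRegularPoint A K ω ((1 - s) • y + s • x) := by
    rintro s ⟨hs0, hs1⟩
    have hw : 0 < B.w ((1 - s) • y + s • x) := by
      rw [affineMap_comb_two _ (by ring), hyco.2.2, hxw]
      nlinarith
    refine hreg _ (hconv hyB hxB (by linarith) hs0.le (by ring)) ?_ ?_
    · intro heq
      rw [heq, B.wa] at hw
      exact lt_irrefl _ hw
    · intro e c' d' he σ hσ heq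
      rw [heq, affineMap_comb_two _ (by ring), B.wa] at hw
      rcases honly e c' d' he with rfl | rfl | rfl
      · rw [B.wb] at hw; simp at hw
      · exact hnc c' d' he
      · have := h.opposite hA hK B
        nlinarith
  have hnear : ∀ᶠ s : ℝ in 𝓝[>] 0, (1 - s) • y + s • x ∈
      interior (convexHull ℝ (({a, b, c} : Finset Plane) : Set Plane)) := by
    have : ContinuousAt (fun s : ℝ => (1 - s) • y + s • x) 0 := by fun_prop
    have h2 := this.tendsto
    simp only [sub_zero, one_smul, zero_smul, add_zero] at h2
    exact (h2.mono_left nhdsWithin_le_nhds).eventually (isOpen_interior.mem_nhds hyint)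
  obtain ⟨σ, ⟨hσ, hσ1⟩, hσ0⟩ := ((hnear.and
    (nhdsWithin_le_nhds (gt_mem_nhds (show (0 : ℝ) < 1 by norm_num)))).and
    self_mem_nhdsWithin).exists
  have hσ0 : 0 < σ := hσ0
  have hσ1 : σ < 1 := hσ1
  have hch := hf.chord_le hA hK hne (hrA hyB) (hrA hxB) hseg' (s := σ) ⟨hσ0.le, hσ1.le⟩
  have hlin := affineMap_comb_two ℓ (show 1 - σ + σ = 1 by ring) y x
  rw [hflc _ (interior_subset hσ), hflc _ (interior_subset hyint), hlin] at hch
  nlinarith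

theorem ReflexHinge.exists_apex (hA : InGeneralPosition A) (hK : IsTriangulation A K)
    {a b c g₁ g₂ : Plane} (h : ReflexHinge K ω a c g₁ g₂) (hT : {a, c, b} ∈ K.faces)
    (hab : a ≠ b) (hcb : c ≠ b) : ∃ g, ReflexHinge K ω a c b g := by
  rcases h.eq_or_eq hA hK hT hab hcb with rfl | rfl
  · exact ⟨g₂, h⟩
  · exact ⟨g₁, h.swap_apex hA hK⟩

/-- Since `a` is a positive combination of `c`, `b`, `g`, the ray from `a` away from `b` starts into
the triangle `acg`. -/
theorem ReflexHinge.eventually_mem_interior (hA : InGeneralPosition A) (hK : IsTriangulation A K)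
    {a b c g : Plane} (h : ReflexHinge K ω a c b g) :
    ∀ᶠ ε : ℝ in 𝓝[>] 0, (1 + ε) • a + (-ε) • b ∈
      interior (convexHull ℝ (({a, c, g} : Finset Plane) : Set Plane)) := by
  obtain ⟨p, q, r, hp, hq, hr, hs, ha⟩ := h.exists_bary_pos hA hK
  obtain ⟨B⟩ := h.toHinge.swap_apex.bary hA hK
  have hv : B.v b = -p / q := by
    have := affineMap_comb_three B.v hs c b g
    rw [← ha, B.va, B.vb, B.vc] at this
    field_simp; linarith
  have hw : B.w b = -r / q := by
    have := affineMap_comb_three B.w hs c b g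
    rw [← ha, B.wa, B.wb, B.wc] at this
    field_simp; linarith
  have hcont : ContinuousAt (fun ε : ℝ => B.u ((1 + ε) • a + (-ε) • b)) 0 := by
    have := affineMap_continuous B.u
    fun_prop
  have hpos : ∀ᶠ ε : ℝ in 𝓝[>] 0, 0 < B.u ((1 + ε) • a + (-ε) • b) := by
    refine nhdsWithin_le_nhds (hcont.eventually (lt_mem_nhds ?_))
    simp [B.ua]
  filter_upwards [hpos, self_mem_nhdsWithin] with ε hε hε0
  have hε0 : 0 < ε := hε0
  rw [coe_triple, B.mem_interior]
  refine ⟨hε, ?_, ?_⟩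
  · rw [affineMap_comb_two _ (by ring), B.va, hv]
    have : 0 < ε * (p / q) := by positivity
    rw [neg_div]; linarith
  · rw [affineMap_comb_two _ (by ring), B.wa, hw]
    have : 0 < ε * (r / q) := by positivity
    rw [neg_div]; linarith

/-- In a triangulation without up-flips, every reflex vertex has a folded edge whose reflex
endpoint is the other one. -/
theorem ReflexAt.exists_next (hA : InGeneralPosition A) (hK : IsTriangulation A K)
    (hno : NoFlip A ω .up K) {a b : Plane} (hba : ReflexAt K ω b a) : ∃ e, ReflexAt K ω a e := by
  by_contra! hnone
  obtain ⟨c, d, h⟩ := hba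
  have hrefl : ∀ e c' d', ConvexHinge K ω a e c' d' → ReflexAt K ω e a := fun e c' d' he =>
    (he.reflexAt_of_noFlip hA hK hno).resolve_right (hnone e)
  have honly : ∀ e c' d', ConvexHinge K ω a e c' d' → e = b ∨ e = c ∨ e = d := by
    intro e c' d' he
    obtain ⟨_, _, he'⟩ := hrefl e c' d' he
    exact h.eq_of_reflexHinge hA hK he'
  obtain ⟨_, _, hc⟩ := h.exists_convexHinge hA hK honly
  obtain ⟨_, _, hd⟩ := (h.swap_apex hA hK).exists_convexHinge hA hK
    (fun e c' d' he => by have := honly e c' d' he; tauto)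
  obtain ⟨_, _, hc'⟩ := hrefl _ _ _ hc
  obtain ⟨_, _, hd'⟩ := hrefl _ _ _ hd
  obtain ⟨g, hg⟩ := hc'.exists_apex hA hK (b := b) (by rw [Finset.pair_comm]; exact h.left)
    h.ab h.bc.symm
  obtain ⟨k, hk⟩ := hd'.exists_apex hA hK (b := b) (by rw [Finset.pair_comm]; exact h.right)
    h.ab h.bd.symm
  -- The ray from `a` away from `b` enters both `acg` and `adk`, so these triangles coincide and
  -- `acd` is a face. This supplies the last lower face for a 3-1 flip at `a`.
  obtain ⟨ε, h1, h2⟩ := ((hg.eventually_mem_interior hA hK).and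
    (hk.eventually_mem_interior hA hK)).exists
  have hsub := hK.subset_of_mem_interior hA hk.right
    ⟨hg.right, card_triple hg.ab hg.ad hg.bd⟩ h1 (interior_subset h2)
    (show c ∈ ({a, c, g} : Finset Plane) by simp)
  simp only [Finset.mem_insert, Finset.mem_singleton] at hsub
  have hck : c = k := by
    rcases hsub with e | e | e
    · exact absurd e.symm h.ac
    · exact absurd e h.cd
    · exact e
  have hacd : {a, c, d} ∈ K.faces := by
    rw [Finset.pair_comm, hck]; exact hk.right
  obtain ⟨B⟩ := h.bary hA hK
  obtain ⟨ℓ, e1, e2, e3, e4⟩ := h.above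
  obtain ⟨β, γ, δ, hβ, hγ, hδ, hs, ha⟩ := h.exists_bary_pos hA hK
  refine hno (exists_flip_of_faces hA hK (h.mem_a hK) (h.mem_b hK) (h.mem_c hK) (h.mem_d hK) B
    h.ab h.ac h.ad h.bc h.bd h.cd e1 e2 e3 e4 h.left ?_ (fun _ => hacd) (fun _ => h.right))
  intro hneg
  have := affineMap_comb_three B.u hs b c d
  rw [← ha, B.ua, B.ub, B.uc] at this
  nlinarith

/-! ### Triangulations without folded edges are extreme -/

/-- If no edge is folded upwards, the lift lies below the planes of its triangles at all vertices. -/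
theorem IsLift.vertex_le (hf : IsLift K ω f) (hA : InGeneralPosition A)
    (hK : IsTriangulation A K) (hreg : ∀ a b c d, ¬ ConvexHinge K ω a b c d) {t : Finset Plane}
    (ht : t ∈ triangles K) {ℓ : Plane →ᵃ[ℝ] ℝ} (hℓ : ∀ p ∈ t, ω p = ℓ p) {p : Plane}
    (hp : p ∈ K.vertices) : ω p ≤ ℓ p := by
  have htne := interior_convexHull_nonempty hA (hK.subset ht.1) ht.2
  have hne := htne.mono (interior_convexHull_mono (hK.subset ht.1))
  have hpA : p ∈ convexHull ℝ (A : Set Plane) := subset_convexHull ℝ _ (hK.vertices_subset hp)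
  have hfp : f p = ω p := by
    obtain ⟨t', ht', hpt'⟩ := hK.exists_triangle hne hpA
    exact hf.apply_vertex hA hK ht' ((SimplicialComplex.vertex_mem_convexHull_iff hp ht'.1).1 hpt')
  -- Choosing `y` off the finitely many lines through `p` and points of `A`, which have measure
  -- zero, keeps the segment from `y` to `p` free of vertices.
  obtain ⟨y, hy, hyl⟩ : ∃ y ∈ interior (convexHull ℝ (t : Set Plane)),
      ∀ v ∈ A, y ∉ affineSpan ℝ (({p, v} : Finset Plane) : Set Plane) := by
    by_contra! hcon
    refine (isOpen_interior.measure_pos MeasureTheory.volume htne).ne'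
      (MeasureTheory.measure_mono_null (t := ⋃ v ∈ (A : Set Plane),
        (affineSpan ℝ (({p, v} : Finset Plane) : Set Plane) : Set Plane)) ?_ ?_)
    · intro y hy
      obtain ⟨v, hv, hyv⟩ := hcon y hy
      exact mem_biUnion (x := v) hv hyv
    · rw [MeasureTheory.measure_biUnion_null_iff A.finite_toSet.countable]
      exact fun v _ => volume_affineSpan_eq_zero Finset.card_le_two
  have hyA : y ∈ interior (convexHull ℝ (A : Set Plane)) :=
    interior_convexHull_mono (hK.subset ht.1) hy
  have hseg : ∀ s ∈ Ioo (0 : ℝ) 1, IsRegularPoint A K ω ((1 - s) • y + s • p) := by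
    rintro s ⟨hs0, hs1⟩
    refine ⟨?_, ?_, fun a b c d _ _ _ _ _ _ => hreg a b c d⟩
    · exact (convex_convexHull ℝ _).openSegment_interior_self_subset_interior hyA hpA
        ⟨1 - s, s, by linarith, hs0, by ring, rfl⟩
    · intro hz
      set z := (1 - s) • y + s • p with hzdef
      refine hyl z (hK.vertices_subset hz) ?_
      have h1 : 1 - s ≠ 0 := by linarith
      have hyz : y = AffineMap.lineMap p z (1 - s)⁻¹ := by
        rw [AffineMap.lineMap_apply_module', hzdef,
          show (1 - s) • y + s • p - p = (1 - s) • (y - p) by module, smul_smul,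
          inv_mul_cancel₀ h1]
        module
      rw [hyz]
      exact AffineMap.lineMap_mem _ (subset_affineSpan ℝ _ (by simp))
        (subset_affineSpan ℝ _ (by simp))
  have hnear : ∀ᶠ s : ℝ in 𝓝[>] 0, (1 - s) • y + s • p ∈
      interior (convexHull ℝ (t : Set Plane)) := by
    have : ContinuousAt (fun s : ℝ => (1 - s) • y + s • p) 0 := by fun_prop
    have h2 := this.tendsto
    simp only [sub_zero, one_smul, zero_smul, add_zero] at h2
    exact (h2.mono_left nhdsWithin_le_nhds).eventually (isOpen_interior.mem_nhds hy)
  obtain ⟨σ, ⟨hσ, hσ1⟩, hσ0⟩ := ((hnear.and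
    (nhdsWithin_le_nhds (gt_mem_nhds (show (0 : ℝ) < 1 by norm_num)))).and
    self_mem_nhdsWithin).exists
  have hσ0 : 0 < σ := hσ0
  have hσ1 : σ < 1 := hσ1
  have hch := hf.chord_le hA hK hne (interior_subset hyA) hpA hseg (s := σ) ⟨hσ0.le, hσ1.le⟩
  have hlin := affineMap_comb_two ℓ (show 1 - σ + σ = 1 by ring) y p
  rw [hf t ht ℓ hℓ _ (interior_subset hσ), hf t ht ℓ hℓ _ (interior_subset hy), hlin, hfp] at hch
  nlinarith

/-- A triangulation without up-flips and without edges folded upwards is extreme. -/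
theorem isExtreme_of_not_convexHinge (hA : InGeneralPosition A) (hω : IsGenericHeight A ω)
    (hK : IsTriangulation A K) (hno : NoFlip A ω .up K)
    (hreg : ∀ a b c d, ¬ ConvexHinge K ω a b c d) : IsExtreme A ω .up K := by
  obtain ⟨f, hf⟩ := exists_isLift hA hK ω
  have hsub : triangles K ⊆ extremeTriangles A ω .up := by
    intro t ht
    have htA := hK.subset ht.1
    have hne := (interior_convexHull_nonempty hA htA ht.2).mono (interior_convexHull_mono htA)
    obtain ⟨ℓ, hℓ⟩ := hA.exists_interpolation ω htA ht.2
    have hvert : ∀ p ∈ K.vertices, ω p ≤ ℓ p := fun p hp => hf.vertex_le hA hK hreg ht hℓ hp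
    have hle : ∀ p ∈ A, ω p ≤ ℓ p := by
      intro p hpA
      by_cases hp : p ∈ K.vertices
      · exact hvert p hp
      obtain ⟨t', ht', hpt'⟩ := hK.exists_triangle hne (subset_convexHull ℝ _ hpA)
      obtain ⟨a, b, c, hab, hac, hbc, rfl⟩ := Finset.card_eq_three.1 ht'.2
      have hmem : ∀ q ∈ ({a, b, c} : Finset Plane), q ∈ K.vertices ∧ q ∈ A ∧ q ≠ p := by
        intro q hq
        have hqv := IsTriangulation.mem_vertices_of_mem ht'.1 hq
        exact ⟨hqv, hK.vertices_subset hqv, fun e => hp (e ▸ hqv)⟩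
      obtain ⟨ha, haA, hap⟩ := hmem a (by simp)
      obtain ⟨hb, hbA, hbp⟩ := hmem b (by simp)
      obtain ⟨hc, hcA, hcp⟩ := hmem c (by simp)
      obtain ⟨B⟩ := hA.bary haA hbA hcA hab hac hbc
      obtain ⟨ℓ', g1, g2, g3⟩ := B.exists_interpolation ω
      rw [coe_triple, B.mem_convexHull] at hpt'
      obtain ⟨h1, h2, h3⟩ := hpt'
      have hlow : ω p ≤ ℓ' p := by
        by_contra! hlt
        exact hno (exists_flip_of_faces hA hK haA hbA hcA hpA B hab hac hap hbc hbp hcp g1.symm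
          g2.symm g3.symm hlt ht'.1 (fun h => absurd h1 h.not_ge) (fun h => absurd h2 h.not_ge)
          (fun h => absurd h3 h.not_ge))
      refine hlow.trans ?_
      rw [B.apply_eq ℓ' p, B.apply_eq ℓ p, g1, g2, g3]
      have := mul_le_mul_of_nonneg_left (hvert a ha) h1
      have := mul_le_mul_of_nonneg_left (hvert b hb) h2
      have := mul_le_mul_of_nonneg_left (hvert c hc) h3
      linarith
    refine ⟨htA, ht.2, hA.affineIndependent_coe htA ht.2, ℓ, hℓ, ?_⟩
    intro p hp hpt
    -- Equality would put four lifted points on one plane.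
    refine lt_of_le_of_ne (hle p hp) fun heq => ?_
    refine hω ℓ (insert p t) (Finset.insert_subset hp htA)
      (by rw [Finset.card_insert_of_notMem hpt, ht.2]) ?_
    intro r hr
    rcases Finset.mem_insert.1 hr with rfl | hr
    · exact heq
    · exact hℓ r hr
  refine ⟨hK, hsub.antisymm ?_⟩
  -- Conversely, an extreme triangle overlaps some triangle of the covering, which is also extreme,
  -- so the two coincide.
  intro t ht
  obtain ⟨x, hx⟩ := interior_convexHull_nonempty hA ht.1 ht.2.1
  have hxA := interior_convexHull_mono ht.1 hx
  obtain ⟨t', ht', hxt'⟩ := hK.exists_triangle ⟨x, hxA⟩ (interior_subset hxA)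
  have h1 := inter_subset_of_extremeTriangles ht (hsub ht') ⟨interior_subset hx, hxt'⟩
  have h2 := (subset_of_mem_interior hA ht.1 ht.2.1 Finset.inter_subset_left hx h1).trans
    Finset.inter_subset_right
  exact Finset.eq_of_subset_of_card_le h2 (by rw [ht'.2, ht.2.1]) ▸ ht'

/-! ### Flippable edges trap the directed path -/

/-- Edges of `K` do not leave a triangle whose sides are edges of `K`. -/
theorem mem_convexHull_of_edge {u v w x y : Plane} (B : Bary u v w) (huv : {u, v} ∈ K.faces)
    (huw : {u, w} ∈ K.faces) (hvw : {v, w} ∈ K.faces)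
    (hx : x ∈ interior (convexHull ℝ ({u, v, w} : Set Plane))) (hxy : {x, y} ∈ K.faces) :
    y ∈ convexHull ℝ ({u, v, w} : Set Plane) := by
  by_contra hy
  have hconn : IsPreconnected (segment ℝ x y) := (convex_segment x y).isPreconnected
  have hcl : IsClosed (convexHull ℝ ({u, v, w} : Set Plane)) := by
    rw [← coe_triple]; exact isClosed_convexHull_finset _
  -- By connectedness an edge leaving the triangle crosses a side. Two edges can meet only if they
  -- share an endpoint, which would have to be `y`, so `y` would be a corner after all.
  obtain ⟨z, hz, hzf⟩ : ∃ z ∈ segment ℝ x y, z ∈ convexHull ℝ ({u, v, w} : Set Plane) ∧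
      z ∉ interior (convexHull ℝ ({u, v, w} : Set Plane)) := by
    by_contra! hcon
    obtain ⟨z, -, hz1, hz2⟩ := hconn _ _ isOpen_interior hcl.isOpen_compl
      (fun z hz => by
        by_cases hzP : z ∈ convexHull ℝ ({u, v, w} : Set Plane)
        · exact Or.inl (hcon z hz hzP)
        · exact Or.inr hzP)
      ⟨x, left_mem_segment ℝ x y, hx⟩ ⟨y, right_mem_segment ℝ x y, hy⟩
    exact hz2 (interior_subset hz1)
  rw [B.mem_convexHull, B.mem_interior] at hzf
  obtain ⟨⟨h1, h2, h3⟩, hn⟩ := hzf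
  obtain ⟨x1, x2, x3⟩ := (B.mem_interior x).1 hx
  have hsum := B.sum_eq z
  have hcomb := B.comb_eq z
  have key : ∀ p q : Plane, {p, q} ∈ K.faces → x ≠ p → x ≠ q →
      p ∈ ({u, v, w} : Set Plane) → q ∈ ({u, v, w} : Set Plane) →
      ∀ α β : ℝ, 0 ≤ α → 0 ≤ β → α + β = 1 → z ≠ α • p + β • q := by
    intro p q hpq hxp hxq hpu hqu α β hα hβ hs hze
    have hz1 : z ∈ convexHull ℝ (({p, q} : Finset Plane) : Set Plane) := by
      rw [Finset.coe_pair, convexHull_pair]; exact ⟨α, β, hα, hβ, hs, hze.symm⟩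
    have hz2 : z ∈ convexHull ℝ (({x, y} : Finset Plane) : Set Plane) := by
      rw [Finset.coe_pair, convexHull_pair]; exact hz
    have hz3 := K.inter_subset_convexHull hpq hxy ⟨hz1, hz2⟩
    obtain ⟨r, hr, hr'⟩ := convexHull_nonempty_iff.1 ⟨z, hz3⟩
    simp only [Finset.coe_pair, mem_insert_iff, mem_singleton_iff] at hr hr'
    have : y = p ∨ y = q := by grind
    rcases this with rfl | rfl
    · exact hy (subset_convexHull ℝ _ hpu)
    · exact hy (subset_convexHull ℝ _ hqu)
  have hxu : x ≠ u := by rintro rfl; rw [B.va] at x2; exact lt_irrefl _ x2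
  have hxv : x ≠ v := by rintro rfl; rw [B.ub] at x1; exact lt_irrefl _ x1
  have hxw : x ≠ w := by rintro rfl; rw [B.uc] at x1; exact lt_irrefl _ x1
  rcases h1.eq_or_lt with e | e
  · rw [← e] at hsum hcomb
    exact key v w hvw hxv hxw (by simp) (by simp) _ _ h2 h3 (by linarith) (by simpa using hcomb)
  rcases h2.eq_or_lt with e' | e'
  · rw [← e'] at hsum hcomb
    exact key u w huw hxu hxw (by simp) (by simp) _ _ h1 h3 (by linarith) (by simpa using hcomb)
  rcases h3.eq_or_lt with e'' | e''
  · rw [← e''] at hsum hcomb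
    exact key u v huv hxu hxv (by simp) (by simp) _ _ h1 h2 (by linarith) (by simpa using hcomb)
  exact hn ⟨e, e', e''⟩

/-- If the edge of a reflex hinge is flippable, the two apexes are joined by an edge. -/
theorem ReflexHinge.pair_mem_faces_of_isFlippable (hA : InGeneralPosition A)
    (hK : IsTriangulation A K) {a b c d : Plane} (h : ReflexHinge K ω a b c d)
    (hflip : IsFlippable K {a, b}) : {c, d} ∈ K.faces := by
  obtain ⟨c', d', hap, S, hSK, hS⟩ := hflip
  have h' := (areApexes_iff h.ab).1 hap
  have hc' := h.eq_or_eq hA hK h'.left h'.ac h'.bc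
  have hd' := h.eq_or_eq hA hK h'.right h'.ad h'.bd
  have hcd' := h'.cd
  obtain ⟨B⟩ := h.bary_reflex hA hK
  have hsub : S.space ⊆ convexHull ℝ ({b, c, d} : Set Plane) := by
    rw [hS]
    refine convexHull_min ?_ (convex_convexHull ℝ _)
    intro p hp
    simp only [Finset.coe_pair, mem_insert_iff, mem_singleton_iff] at hp
    have : p = a ∨ p ∈ ({b, c, d} : Set Plane) := by
      simp only [mem_insert_iff, mem_singleton_iff]; grind
    rcases this with rfl | hp
    · exact interior_subset h.reflex
    · exact subset_convexHull ℝ _ hp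
  -- The face of `S` containing the midpoint of `cd` lies in the triangle, of which `cd` is a side.
  -- Only its vertices on the line `cd` carry `m`; by general position these are among `c` and `d`,
  -- and both are needed.
  set m : Plane := (1 / 2 : ℝ) • c + (1 / 2 : ℝ) • d with hm
  have hmS : m ∈ S.space := by
    rw [hS]
    have hc : c ∈ (insert c' (insert d' ((({a, b} : Finset Plane)) : Set Plane))) := by
      simp only [mem_insert_iff]; grind
    have hd : d ∈ (insert c' (insert d' ((({a, b} : Finset Plane)) : Set Plane))) := by
      simp only [mem_insert_iff]; grind
    exact convex_convexHull ℝ _ (subset_convexHull ℝ _ hc) (subset_convexHull ℝ _ hd)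
      (by norm_num) (by norm_num) (by norm_num)
  obtain ⟨s, hsS, hms⟩ := SimplicialComplex.mem_space_iff.1 hmS
  have hs := hSK hsS
  have hpos : ∀ p ∈ s, 0 ≤ B.u p := fun p hp =>
    (B.mem_convexHull.1 (hsub (S.subset_space hsS hp))).1
  have hm0 : B.u m = 0 := by
    rw [hm, affineMap_comb_two _ (by norm_num), B.ub, B.uc]; simp
  have hmf := mem_convexHull_filter_of_eq_zero B.u hpos hms hm0
  have hpts : ∀ p ∈ s, B.u p = 0 → p = c ∨ p = d := by
    intro p hp hp0
    by_contra! hne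
    obtain ⟨B'⟩ := hA.bary (h.mem_c hK) (h.mem_d hK) (hK.subset hs hp) h.cd hne.1.symm hne.2.symm
    have := B'.apply_eq B.u b
    rw [B.ua, B.ub, B.uc, hp0] at this
    simp at this
  have hcs : c ∈ s := by
    by_contra hn
    have h0 := eq_of_mem_convexHull B.v 0 (fun p hp => by
      simp only [Finset.coe_filter, mem_ofPred_eq] at hp
      rcases hpts p hp.1 hp.2 with rfl | rfl
      · exact absurd hp.1 hn
      · simp [B.vc]) hmf
    rw [hm, affineMap_comb_two _ (by norm_num), B.vb, B.vc] at h0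
    simp at h0
  have hds : d ∈ s := by
    by_contra hn
    have h0 := eq_of_mem_convexHull B.w 0 (fun p hp => by
      simp only [Finset.coe_filter, mem_ofPred_eq] at hp
      rcases hpts p hp.1 hp.2 with rfl | rfl
      · simp [B.wb]
      · exact absurd hp.1 hn) hmf
    rw [hm, affineMap_comb_two _ (by norm_num), B.wb, B.wc] at h0
    simp at h0
  exact K.down_closed hs (by simp [Finset.insert_subset_iff, hcs, hds]) (by simp)

/-- A sequence of reflex edges that passes a flippable edge never returns to its first endpoint. -/
theorem ne_of_isFlippable (hA : InGeneralPosition A) (hK : IsTriangulation A K) {x : ℕ → Plane}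
    (hx : ∀ i, ReflexAt K ω (x i) (x (i + 1))) (i : ℕ) (hflip : IsFlippable K {x i, x (i + 1)})
    (k : ℕ) : x (i + 1 + k) ≠ x i := by
  obtain ⟨c, d, h⟩ := hx i
  obtain ⟨B⟩ := h.bary_reflex hA hK
  have hcd := h.pair_mem_faces_of_isFlippable hA hK (by rwa [Finset.pair_comm])
  have hbc : {x i, c} ∈ K.faces := K.down_closed h.left (by intro p; simp; tauto) (by simp)
  have hbd : {x i, d} ∈ K.faces := K.down_closed h.right (by intro p; simp; tauto) (by simp)
  have hmem : ∀ k, x (i + 1 + k) ∈ interior (convexHull ℝ ({x i, c, d} : Set Plane)) := by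
    intro k
    induction k with
    | zero => exact h.reflex
    | succ k ih =>
      obtain ⟨c', d', h'⟩ := hx (i + 1 + k)
      refine h'.mem_interior_of_mem (convex_convexHull ℝ _) (interior_subset ih) ?_ ?_
      · exact mem_convexHull_of_edge B hbc hbd hcd ih
          (K.down_closed h'.left (by intro p; simp; tauto) (by simp))
      · exact mem_convexHull_of_edge B hbc hbd hcd ih
          (K.down_closed h'.right (by intro p; simp; tauto) (by simp))
  intro heq
  exact B.not_mem_interior_left (heq ▸ hmem k)

/-! ### Extracting the cycle -/

/-- A periodic sequence of adjacent vertices is a closed walk along a cycle graph. -/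
theorem exists_cycleGraph_hom {V : Type*} (G : SimpleGraph V) {x : ℕ → V} {m : ℕ}
    (hadj : ∀ i, G.Adj (x i) (x (i + 1))) (hper : x (m + 3) = x 0) :
    ∃ φ : SimpleGraph.cycleGraph (m + 3) →g G, ∀ i, φ i = x i := by
  have hsucc : ∀ i : Fin (m + 3), G.Adj (x i) (x (i + 1 : Fin (m + 3))) := by
    intro i
    rw [Fin.val_add_one]
    split_ifs with hi
    · subst hi
      have := hadj (m + 2)
      rw [hper] at this
      simpa using this
    · exact hadj i
  refine ⟨⟨fun i => x i, ?_⟩, fun _ => rfl⟩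
  intro u v huv
  rw [SimpleGraph.cycleGraph_adj] at huv
  rcases huv with h | h
  · have e : u = v + 1 := by rw [← h]; abel
    rw [e]; exact (hsucc v).symm
  · have e : v = u + 1 := by rw [← h]; abel
    rw [e]; exact hsucc u

/-- A triangulation without up-flips that is not extreme contains an injective cycle of blocked
edges through redundant vertices. -/
theorem exists_blocked_cycle (hA : InGeneralPosition A) (hω : IsGenericHeight A ω)
    (hK : IsTriangulation A K) (hno : NoFlip A ω .up K) (hext : ¬ IsExtreme A ω .up K) :
    ∃ (m : ℕ) (φ : SimpleGraph.cycleGraph (m + 3) →g blockedGraph ω .up K),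
      Function.Injective φ ∧ ∀ i, IsRedundant A ω .up K (φ i) := by
  have hstart : ∃ b a, ReflexAt K ω b a := by
    by_contra! hcon
    refine hext (isExtreme_of_not_convexHinge hA hω hK hno fun a b c d h => ?_)
    rcases h.reflexAt_of_noFlip hA hK hno with h1 | h1
    · exact hcon _ _ h1
    · exact hcon _ _ h1
  let V : Set Plane := {a | ∃ b, ReflexAt K ω b a}
  have hVfin : V.Finite := A.finite_toSet.subset fun a ⟨b, hb⟩ => (hb.isRedundant hA hK).2.1.1
  have : Finite V := hVfin.to_subtype
  have hnext : ∀ a : V, ∃ e : V, ReflexAt K ω a e := by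
    rintro ⟨a, b, hb⟩
    obtain ⟨e, he⟩ := hb.exists_next hA hK hno
    exact ⟨⟨e, a, he⟩, he⟩
  choose F hF using hnext
  obtain ⟨b, a, hba⟩ := hstart
  obtain ⟨i, j, hij, heq⟩ := Finite.exists_ne_map_eq_of_infinite
    (fun n : ℕ => F^[n] (⟨a, b, hba⟩ : V))
  obtain ⟨y, hy⟩ : ∃ y : V, y ∈ Function.periodicPts F := by
    wlog hlt : i < j generalizing i j
    · exact this j i hij.symm heq.symm (lt_of_le_of_ne (not_lt.1 hlt) hij.symm)
    refine ⟨F^[i] ⟨a, b, hba⟩, j - i, by omega, ?_⟩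
    change F^[j - i] (F^[i] _) = _
    rw [← Function.iterate_add_apply, Nat.sub_add_cancel hlt.le]
    exact heq.symm
  -- Taking the minimal period makes the cycle injective; asymmetry excludes the periods 1 and 2.
  set n := Function.minimalPeriod F y with hn
  have hn0 : 0 < n := Function.minimalPeriod_pos_of_mem_periodicPts hy
  have hiter : F^[n] y = y := Function.iterate_minimalPeriod
  set x : ℕ → Plane := fun i => (F^[i] y : V) with hx
  have hR : ∀ i, ReflexAt K ω (x i) (x (i + 1)) := by
    intro i
    simp only [hx, Function.iterate_succ_apply']
    exact hF _
  have hper : ∀ i, x (i + n) = x i := by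
    intro i
    simp only [hx, Function.iterate_add_apply, hiter]
  have hn1 : n ≠ 1 := by
    intro h1
    have h2 := hR 0
    have h3 := hper 0
    rw [h1] at h3
    rw [h3] at h2
    exact h2.asymm hA hK h2
  have hn2 : n ≠ 2 := by
    intro h1
    have h2 := hR 0
    have h4 := hR 1
    have h3 := hper 0
    rw [h1] at h3
    rw [show 1 + 1 = 0 + 2 from rfl, h3] at h4
    exact h2.asymm hA hK h4
  obtain ⟨m, hm⟩ : ∃ m, n = m + 3 := ⟨n - 3, by omega⟩
  have hadj : ∀ i, (blockedGraph ω .up K).Adj (x i) (x (i + 1)) := by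
    intro i
    obtain ⟨c, d, h⟩ := hR i
    refine ⟨h.ab.symm, (isLocallyNonRegular_up_iff h.ab.symm).2 ⟨c, d, h.swap_edge⟩, ?_⟩
    intro hflip
    -- The trapped path starts at index `i + 1`, so `n - 1` further steps return to `x i`.
    refine ne_of_isFlippable hA hK hR i hflip (n - 1) ?_
    rw [show i + 1 + (n - 1) = i + n by omega, hper]
  obtain ⟨φ, hφ⟩ := exists_cycleGraph_hom (blockedGraph ω .up K) (m := m) hadj
    (by rw [← hm]; simpa using hper 0)
  refine ⟨m, φ, ?_, ?_⟩
  · intro u v huv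
    rw [hφ, hφ] at huv
    have := Function.iterate_injOn_Iio_minimalPeriod (f := F) (x := y)
      (show (u : ℕ) ∈ Iio n by rw [hm]; exact u.2) (show (v : ℕ) ∈ Iio n by rw [hm]; exact v.2)
      (Subtype.ext huv)
    exact Fin.ext this
  · intro i
    rw [hφ]
    exact (F^[i] y).2.choose_spec.isRedundant hA hK

/-! ### Exchanging directions by negating heights -/

theorem Dir.lt_opp_neg (s : Dir) (a b : ℝ) : s.opp.lt (-a) (-b) ↔ s.lt a b := by
  cases s <;> simp [Dir.lt, Dir.opp]

theorem Dir.opp_opp (s : Dir) : s.opp.opp = s := by cases s <;> rfl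

/-- Reindexes the witnessing planes so that they are negated together with the heights. -/
theorem exists_neg_affineMap {P : (Plane →ᵃ[ℝ] ℝ) → Prop} :
    (∃ ℓ : Plane →ᵃ[ℝ] ℝ, P (-ℓ)) ↔ ∃ ℓ, P ℓ :=
  ⟨fun ⟨ℓ, h⟩ => ⟨-ℓ, h⟩, fun ⟨ℓ, h⟩ => ⟨-ℓ, by rwa [neg_neg]⟩⟩

theorem extremeTriangles_neg (B : Finset Plane) (ω : Plane → ℝ) (s : Dir) :
    extremeTriangles B (-ω) s.opp = extremeTriangles B ω s := by
  ext t
  unfold extremeTriangles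
  simp only [mem_ofPred_eq]
  rw [← exists_neg_affineMap]
  simp [Dir.lt_opp_neg]

theorem isLocallyNonRegular_neg (ω : Plane → ℝ) (s : Dir) (e : Finset Plane) :
    IsLocallyNonRegular (-ω) s.opp K e ↔ IsLocallyNonRegular ω s K e := by
  unfold IsLocallyNonRegular
  refine exists_congr fun c => exists_congr fun d => and_congr_right fun _ => ?_
  rw [← exists_neg_affineMap]
  simp [Dir.lt_opp_neg]

theorem blockedGraph_neg (ω : Plane → ℝ) (s : Dir) :
    blockedGraph (-ω) s.opp K = blockedGraph ω s K := by
  ext a b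
  simp only [blockedGraph, isLocallyNonRegular_neg]

theorem isRedundant_neg (ω : Plane → ℝ) (s : Dir) (a : Plane) :
    IsRedundant A (-ω) s.opp K a ↔ IsRedundant A ω s K a := by
  unfold IsRedundant IsInteriorToward
  rw [extremeTriangles_neg]

theorem isExtreme_neg (ω : Plane → ℝ) (s : Dir) :
    IsExtreme A (-ω) s.opp K ↔ IsExtreme A ω s K := by
  unfold IsExtreme
  rw [extremeTriangles_neg]

theorem noFlip_neg (ω : Plane → ℝ) (s : Dir) :
    NoFlip A (-ω) s.opp K ↔ NoFlip A ω s K := by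
  unfold NoFlip Flip
  simp only [extremeTriangles_neg]

theorem IsGenericHeight.neg (hω : IsGenericHeight A ω) : IsGenericHeight A (-ω) := by
  intro ℓ q hq h4 h
  refine hω (-ℓ) q hq h4 fun p hp => ?_
  have := h p hp
  simp only [Pi.neg_apply] at this
  simp [← this]

theorem exists_blocked_cycle_dir (hA : InGeneralPosition A) (hω : IsGenericHeight A ω)
    (hK : IsTriangulation A K) (s : Dir) (hno : NoFlip A ω s K) (hext : ¬ IsExtreme A ω s K) :
    ∃ (m : ℕ) (φ : SimpleGraph.cycleGraph (m + 3) →g blockedGraph ω s K),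
      Function.Injective φ ∧ ∀ i, IsRedundant A ω s K (φ i) := by
  cases s
  · exact exists_blocked_cycle hA hω hK hno hext
  · have := exists_blocked_cycle hA hω.neg hK ((noFlip_neg ω .down).2 hno)
      (fun h => hext ((isExtreme_neg ω .down).1 h))
    rw [show Dir.up = Dir.down.opp from rfl, blockedGraph_neg] at this
    simpa only [isRedundant_neg] using this

theorem Flip.reverse {K' : SimplicialComplex ℝ Plane} {s : Dir} (h : Flip A ω s K K') :
    Flip A ω s.opp K' K := by
  obtain ⟨h1, h2, q, hq, h4, h5, h6, h7⟩ := h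
  exact ⟨h2, h1, q, hq, h4, by rwa [Dir.opp_opp], h5, by rw [Dir.opp_opp]; exact h7.symm⟩

end DirectedFlips

/-! ### The main theorem -/

theorem mainTheorem3
    (A : Finset DirectedFlips.Plane) (hA : DirectedFlips.InGeneralPosition A)
    (ω : DirectedFlips.Plane → ℝ) (hω : DirectedFlips.IsGenericHeight A ω)
    (K : Geometry.SimplicialComplex ℝ DirectedFlips.Plane)
    (hK : DirectedFlips.IsNonExtreme A ω K) :
    (∃ s : DirectedFlips.Dir, DirectedFlips.NoFlip A ω s K) ∧
    ∀ s : DirectedFlips.Dir, DirectedFlips.NoFlip A ω s K →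
      3 ≤ {a | DirectedFlips.IsRedundant A ω s K a}.ncard ∧
      (∃ (u : DirectedFlips.Plane) (w : (DirectedFlips.blockedGraph ω s K).Walk u u),
        w.IsCycle ∧ ∀ a ∈ w.support, DirectedFlips.IsRedundant A ω s K a) ∧
      ((∀ a, DirectedFlips.IsInterior A a →
          DirectedFlips.IsInteriorToward A ω s a ∨
            DirectedFlips.IsInteriorToward A ω s.opp a) →
        ∀ a, DirectedFlips.IsRedundant A ω s K a →
          DirectedFlips.IsInteriorToward A ω s.opp a) := by
  obtain ⟨⟨hT, hext⟩, hne⟩ := hK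
  constructor
  · by_contra! hcon
    obtain ⟨K₁, h₁⟩ := not_not.1 (hcon .down)
    exact hext ⟨⟨K₁, h₁.reverse⟩, not_not.1 (hcon .up)⟩
  intro s hno
  obtain ⟨m, φ, hinj, hred⟩ :=
    DirectedFlips.exists_blocked_cycle_dir hA hω hT s hno (hne s)
  refine ⟨?_, ⟨_, (SimpleGraph.cycleGraph.cycle m).map φ, ?_, ?_⟩, ?_⟩
  -- The injective cycle already supplies `m + 3` redundant vertices. Finiteness is needed because
  -- `Set.ncard` is 0 on infinite sets.
  · have hfin : {a | DirectedFlips.IsRedundant A ω s K a}.Finite :=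
      A.finite_toSet.subset fun a ha => ha.2.1.1
    have h1 : (Set.range φ).ncard = m + 3 := by
      rw [← Set.image_univ, Set.ncard_image_of_injective _ hinj, Set.ncard_univ, Nat.card_fin]
    have h2 := Set.ncard_le_ncard (Set.range_subset_iff.2 hred) hfin
    omega
  · exact (SimpleGraph.cycleGraph.isCycle_cycle).map hinj
  · intro a ha
    rw [SimpleGraph.Walk.support_map] at ha
    obtain ⟨i, -, rfl⟩ := List.mem_map.1 ha
    exact hred i
  · intro h a ha
    exact (h a ha.2.1).resolve_left ha.2.2
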